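/- Let $a_1<a_2<a_3<a_4$ (also written $a<b<c<d$) be natural numbers with $\gcd(a_1,a_2,a_3,a_4)=1$ such that every number of the form $a_1^{p}a_2^{q}a_3^{l}a_4^{f}$ with $p,q,l,f\in\mathbb{N}_0$ has only one such representation (this holds, for instance, if the $a_i$ are at least $2$ and pairwise coprime). For real $x$ let $$N_{a,b,c,d}(x)=\#\{(p,q,l,f)\in\mathbb{N}_0^4: a_1^{p}a_2^{q}a_3^{l}a_4^{f}\le x\},$$ let $\chi$ be the characteristic function of $S_{a,b,c,d}=\{a_1^{p}a_2^{q}a_3^{l}a_4^{f}: p,q,l,f\in\mathbb{N}_0\}$, and let $B_1^*(\{t\})=\{t\}-\frac12$ if $t\notin\mathbb{Z}$ and $B_1^*(\{t\})=0$ if $t\in\mathbb{Z}$. Write $L=\log x$, $\ell_i=\log a_i$ and $\Pi=\ell_1\ell_2\ell_3\ell_4$. For $R>0$ and distinct indices put $$P_{ij}(R)=\sum_{k=1}^{\lfloor R\ell_i\rfloor}\frac{\cos\left(2\pi k\frac{L-\frac12\ell_j}{\ell_i}\right)}{k\sin\left(\frac{\pi k\ell_j}{\ell_i}\right)}+\sum_{k=1}^{\lfloor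 R\ell_j\rfloor}\frac{\cos\left(2\pi k\frac{L-\frac12\ell_i}{\ell_j}\right)}{k\sin\left(\frac{\pi k\ell_i}{\ell_j}\right)},$$ $$D_{i;jm}(R)=\sum_{k=1}^{\lfloor R\ell_i\rfloor}\left(\frac{\sin\left(2\pi k\frac{L+\frac12\ell_j-\frac12\ell_m}{\ell_i}\right)}{k\sin\left(\frac{\pi k\ell_j}{\ell_i}\right)\sin\left(\frac{\pi k\ell_m}{\ell_i}\right)}+\frac{\sin\left(2\pi k\frac{L-\frac12\ell_j+\frac12\ell_m}{\ell_i}\right)}{k\sin\left(\frac{\pi k\ell_j}{\ell_i}\right)\sin\left(\frac{\pi k\ell_m}{\ell_i}\right)}\right),$$ $$C_i(R)=\sum_{k=1}^{\lfloor R\ell_i\rfloor}\frac{1}{k}\cos\left(2\pi k\frac{L}{\ell_i}\right)\prod_{j\ne i}\cot\left(\frac{\pi k\ell_j}{\ell_i}\right),$$ and $T_{ijm}(R)=D_{i;jm}(R)+D_{j;im}(R)+D_{m;ij}(R)$, $Q(R)=C_1(R)+C_2(R)+C_3(R)+C_4(R)$. For $\delta>0$ let $G_\delta$ be the set of all real $R$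 with $|R-k/\ell_i|\ge\delta$ for all $k\in\mathbb{N}_0$ and $1\le i\le 4$. For all sufficiently small $\delta>0$ the set $G_\delta$ contains arbitrarily large $R$. For every real $x\ge1$ there are real numbers $P_{ij}$ ($i<j$), $T_{ijm}$ ($i<j<m$) and $Q$ such that, for every $\delta>0$, as $R\to\infty$ with $R\in G_\delta$, $P_{ij}(R)\to P_{ij}$, $T_{ijm}(R)\to T_{ijm}$ and $Q(R)\to Q$, and $$\begin{aligned}N_{a,b,c,d}(x)={}&\frac{L^4}{24\,\Pi}+\sum_{i<j<m}\frac{L^3}{12\,\ell_i\ell_j\ell_m}+\sum_{i}\frac{\ell_i^2L^2}{24\,\Pi}+\sum_{i<j}\frac{L^2}{8\,\ell_i\ell_j}+\sum_i\frac{L}{8\,\ell_i}+\sum_i\sum_{\substack{j<m\\ j,m\ne i}}\frac{\ell_iL}{24\,\ell_j\ell_m}\\&+\frac1{16}+\sum_{i\ne j}\frac{\ell_i}{48\,\ell_j}+\sum_{i<j}\frac{\ell_i^2\ell_j^2}{144\,\Pi}-\sum_i\frac{\ell_i^4}{720\,\Pi}-\frac78\sum_iB_1^*\left(\left\{\frac{L}{\ell_i}\right\}\right)\\&-\frac1{8\pi}\sum_{i<j}P_{ij}-\frac1{16\pi}\sum_{i<j<m}T_{ijm}+\frac1{8\pi}Q+\frac12\chi(x).\end{aligned}$$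 -/

import Mathlib

open Real Set Filter Topology

namespace SmoothCount

/-- The number `a ^ p * b ^ q * c ^ l * d ^ f` attached to the exponents `e = (p, q, l, f)`. -/
def monomial (a b c d : ℕ) (e : ℕ × ℕ × ℕ × ℕ) : ℕ :=
  a ^ e.1 * b ^ e.2.1 * c ^ e.2.2.1 * d ^ e.2.2.2

/-- `N_{a,b,c,d}(x)`: the number of exponent quadruples `(p, q, l, f)` of natural numbers with
`a ^ p * b ^ q * c ^ l * d ^ f ≤ x`. -/
noncomputable def N (a b c d : ℕ) (x : ℝ) : ℕ :=
  Set.ncard {e : ℕ × ℕ × ℕ × ℕ | (monomial a b c d e : ℝ) ≤ x}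

/-- The set `S_{a,b,c,d}` of the numbers `a ^ p * b ^ q * c ^ l * d ^ f`. -/
def S (a b c d : ℕ) : Set ℝ :=
  Set.range fun e : ℕ × ℕ × ℕ × ℕ => (monomial a b c d e : ℝ)

/-- The characteristic function of `S_{a,b,c,d}`. -/
noncomputable def chi (a b c d : ℕ) : ℝ → ℝ :=
  Set.indicator (S a b c d) fun _ => 1

open Classical in
/-- `B₁*({t})`: the value `{t} - 1/2` if `t` is not an integer, and `0` if `t` is an integer. -/
noncomputable def B1star (t : ℝ) : ℝ :=
  if t ∈ Set.range (fun n : ℤ => (n : ℝ)) then 0 else Int.fract t - 1 / 2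

/-- The quartic polynomial in `log x` of the formula. -/
noncomputable def mainPoly (a b c d x : ℝ) : ℝ :=
    log x ^ 4 / (24 * log a * log b * log c * log d) + log x ^ 3 / (12 * log a * log b * log c)
      + log x ^ 3 / (12 * log a * log b * log d) + log x ^ 3 / (12 * log a * log c * log d)
      + log x ^ 3 / (12 * log b * log c * log d)
      + log a * log x ^ 2 / (24 * log b * log c * log d)
      + log b * log x ^ 2 / (24 * log a * log c * log d)
      + log c * log x ^ 2 / (24 * log a * log b * log d)
      + log d * log x ^ 2 / (24 * log a * log b * log c) + log x ^ 2 / (8 * log a * log b)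
      + log x ^ 2 / (8 * log a * log c) + log x ^ 2 / (8 * log a * log d)
      + log x ^ 2 / (8 * log b * log c) + log x ^ 2 / (8 * log b * log d)
      + log x ^ 2 / (8 * log c * log d) + log x / (8 * log a) + log x / (8 * log b)
      + log x / (8 * log c) + log x / (8 * log d) + log a * log x / (24 * log b * log c)
      + log a * log x / (24 * log b * log d) + log a * log x / (24 * log c * log d)
      + log b * log x / (24 * log a * log c) + log b * log x / (24 * log a * log d)
      + log b * log x / (24 * log c * log d) + log c * log x / (24 * log a * log b)
      + log c * log x / (24 * log a * log d) + log c * log x / (24 * log b * log d)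
      + log d * log x / (24 * log a * log b) + log d * log x / (24 * log a * log c)
      + log d * log x / (24 * log b * log c) + 1 / 16 + log a / (48 * log b)
      + log a / (48 * log c) + log a / (48 * log d) + log b / (48 * log a)
      + log b / (48 * log c) + log b / (48 * log d) + log c / (48 * log a)
      + log c / (48 * log b) + log c / (48 * log d) + log d / (48 * log a)
      + log d / (48 * log b) + log d / (48 * log c) + log a * log b / (144 * log c * log d)
      + log a * log c / (144 * log b * log d) + log a * log d / (144 * log b * log c)
      + log b * log c / (144 * log a * log d) + log b * log d / (144 * log a * log c)
      + log c * log d / (144 * log a * log b) - log a ^ 3 / (720 * log b * log c * log d)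
      - log b ^ 3 / (720 * log a * log c * log d) - log c ^ 3 / (720 * log a * log b * log d)
      - log d ^ 3 / (720 * log a * log b * log c)

/-- The pairwise series of the bases `u` and `v`, cut off at `R`. -/
noncomputable def pairSum (u v x R : ℝ) : ℝ :=
  ∑ k ∈ Finset.Icc 1 ⌊R * log u⌋₊,
      cos (2 * π * k * ((log x - 1 / 2 * log v) / log u)) / (k * sin (π * k * log v / log u))
    + ∑ k ∈ Finset.Icc 1 ⌊R * log v⌋₊,
      cos (2 * π * k * ((log x - 1 / 2 * log u) / log v)) / (k * sin (π * k * log u / log v))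

/-- The series to the base `u` with the two sines of `v` and `w` in the denominators, cut off
at `R`. -/
noncomputable def doubleSineSum (u v w x R : ℝ) : ℝ :=
  ∑ k ∈ Finset.Icc 1 ⌊R * log u⌋₊,
    (sin (2 * π * k * ((log x + 1 / 2 * log v - 1 / 2 * log w) / log u))
        / (k * sin (π * k * log v / log u) * sin (π * k * log w / log u))
      + sin (2 * π * k * ((log x - 1 / 2 * log v + 1 / 2 * log w) / log u))
        / (k * sin (π * k * log v / log u) * sin (π * k * log w / log u)))

/-- The triple-cotangent cosine series to the base `u`, with the cotangents of `v`, `w` and `z`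
written as quotients of cosines and sines, cut off at `R`. -/
noncomputable def tripleCotSum (u v w z x R : ℝ) : ℝ :=
  ∑ k ∈ Finset.Icc 1 ⌊R * log u⌋₊,
    cos (π * k * log v / log u) * cos (π * k * log w / log u) * cos (π * k * log z / log u)
        * cos (2 * π * k * (log x / log u))
      / (k * sin (π * k * log v / log u) * sin (π * k * log w / log u)
          * sin (π * k * log z / log u))

/-- The double-sine series to the three bases `u`, `v`, `w` with a common cut-off parameter `R`. -/
noncomputable def doubleSineTriple (u v w x R : ℝ) : ℝ :=
  doubleSineSum u v w x R + doubleSineSum v u w x R + doubleSineSum w u v x R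

/-- The triple-cotangent series to the four bases with a common cut-off parameter `R`. -/
noncomputable def tripleCotQuadruple (u v w z x R : ℝ) : ℝ :=
  tripleCotSum u v w z x R + tripleCotSum v u w z x R + tripleCotSum w u v z x R
    + tripleCotSum z u v w x R

/-- The cut-off parameters `R` that keep a distance at least `δ` from all the points `k / log u`,
where `u` is one of the four bases: these are the values at which some cut-off `⌊R * log u⌋`
jumps. -/
def goodCutoffs (a b c d : ℕ) (δ : ℝ) : Set ℝ :=
  {R | ∀ u ∈ ({a, b, c, d} : Set ℕ), ∀ k : ℕ, δ ≤ |R - k / log u|}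

/-- `R → ∞` through the cut-off parameters that keep the distance `δ` from all jumps. -/
def cutoffFilter (a b c d : ℕ) (δ : ℝ) : Filter ℝ :=
  atTop ⊓ 𝓟 (goodCutoffs a b c d δ)

end SmoothCount

namespace SmoothCount

/-! The proof is Perron's formula with an explicit contour. Put `y = log x` and let the periods `ℓ
i` be the logarithms of the four bases. The kernel `exp (s * y) / s * ∏ (1 - exp (-s * ℓ i))⁻¹` is
integrated over the boundary of the rectangle `[-√R, √R] × [-2πR, 2πR]`, and the integral is
evaluated in two ways.

Analytically, its limit is the number of lattice points `∑ n i * ℓ i ≤ y`, with weight `1 / 2` on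
equality (`tendsto_perronIntegral`). For `-∑ ℓ i < y < 0` the kernel decays on both vertical sides
and a crude estimate gives the limit zero. Multiplication by `1 - exp (-s * a)` removes one factor
and shifts `y` by `a`, so the contour integral and the count obey the same recursion, which carries
the result to all larger `y`. The estimates need the horizontal sides to stay away from the poles
`2πik / ℓ i`, which is what the restriction on `R` provides. By unique factorization the count is `N
- χ / 2` (`latticeCount_eq_N_sub_chi`).

By residues (`rectIntegral_eq_residues`), the origin contributes a Taylor coefficient of `exp (s *
y) * ∏ toddFactor`, which is the polynomial `mainPoly`. The other poles are simple, since the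
logarithms are pairwise incommensurable. The poles with index `k` and `-k` together give sine and
cosine terms multiplied by products of cotangents.

For four periods this yields only the convergence of one large combination of series. The same
argument for each single period, pair and triple shows successively that the sawtooth series, the
pairs of cosine-cotangent series and the triples of sine-cotangent-cotangent series converge.
Subtracting them leaves the triple-cotangent series. Addition formulas turn these into the series of
the statement, and the sawtooth terms set free in this way account for the factor `7 / 8`. -/

/-! ### Contour integrals over rectangles and the residue theorem -/

/-- The integral of `f` along the positively oriented boundary of the rectangle
`[-W, W] × [-T, T]`. -/
noncomputable def rectIntegral (W T : ℝ) (f : ℂ → ℂ) : ℂ :=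
  (∫ x : ℝ in (-W)..W, f (x + (-T : ℝ) * Complex.I)) - (∫ x : ℝ in (-W)..W, f (x + T * Complex.I))
    + Complex.I * (∫ y : ℝ in (-T)..T, f (W + y * Complex.I))
    - Complex.I * (∫ y : ℝ in (-T)..T, f ((-W : ℝ) + y * Complex.I))

/-- The boundary of the rectangle `[-W, W] × [-T, T]`. -/
def rectBoundary (W T : ℝ) : Set ℂ :=
  {s | (|s.re| ≤ W ∧ |s.im| = T) ∨ (|s.re| = W ∧ |s.im| ≤ T)}

variable {W T : ℝ}

lemma mem_rectBoundary_bottom (hT : 0 < T) {x : ℝ} (hx : |x| ≤ W) :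
    (x + (-T : ℝ) * Complex.I : ℂ) ∈ rectBoundary W T := by
  left; simp [abs_of_pos hT, hx]

lemma mem_rectBoundary_top (hT : 0 < T) {x : ℝ} (hx : |x| ≤ W) :
    (x + T * Complex.I : ℂ) ∈ rectBoundary W T := by
  left; simp [abs_of_pos hT, hx]

lemma mem_rectBoundary_right (hW : 0 < W) {y : ℝ} (hy : |y| ≤ T) :
    (W + y * Complex.I : ℂ) ∈ rectBoundary W T := by
  right; simp [abs_of_pos hW, hy]

lemma mem_rectBoundary_left (hW : 0 < W) {y : ℝ} (hy : |y| ≤ T) :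
    ((-W : ℝ) + y * Complex.I : ℂ) ∈ rectBoundary W T := by
  right; simp [abs_of_pos hW, hy]

lemma abs_le_of_mem_uIcc_neg {r x : ℝ} (hr : 0 < r) (hx : x ∈ uIcc (-r) r) : |x| ≤ r := by
  rw [uIcc_of_le (by linarith)] at hx
  exact abs_le.2 hx

lemma rectIntegral_congr (hW : 0 < W) (hT : 0 < T) {f g : ℂ → ℂ}
    (h : ∀ s ∈ rectBoundary W T, f s = g s) : rectIntegral W T f = rectIntegral W T g := by
  unfold rectIntegral
  congr 1
  · congr 1
    · congr 1
      · exact intervalIntegral.integral_congr fun x hx =>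
          h _ (mem_rectBoundary_bottom hT (abs_le_of_mem_uIcc_neg hW hx))
      · exact intervalIntegral.integral_congr fun x hx =>
          h _ (mem_rectBoundary_top hT (abs_le_of_mem_uIcc_neg hW hx))
    · congr 1
      exact intervalIntegral.integral_congr fun x hx =>
          h _ (mem_rectBoundary_right hW (abs_le_of_mem_uIcc_neg hT hx))
  · congr 1
    exact intervalIntegral.integral_congr fun x hx =>
          h _ (mem_rectBoundary_left hW (abs_le_of_mem_uIcc_neg hT hx))

lemma intervalIntegrable_bottom (hW : 0 < W) (hT : 0 < T) {f : ℂ → ℂ}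
    (hf : ContinuousOn f (rectBoundary W T)) :
    IntervalIntegrable (fun x : ℝ => f (x + (-T : ℝ) * Complex.I)) MeasureTheory.volume (-W) W :=
  ContinuousOn.intervalIntegrable <| hf.comp (by fun_prop) fun _ hx =>
    mem_rectBoundary_bottom hT (abs_le_of_mem_uIcc_neg hW hx)

lemma intervalIntegrable_top (hW : 0 < W) (hT : 0 < T) {f : ℂ → ℂ}
    (hf : ContinuousOn f (rectBoundary W T)) :
    IntervalIntegrable (fun x : ℝ => f (x + T * Complex.I)) MeasureTheory.volume (-W) W :=
  ContinuousOn.intervalIntegrable <| hf.comp (by fun_prop) fun _ hx =>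
    mem_rectBoundary_top hT (abs_le_of_mem_uIcc_neg hW hx)

lemma intervalIntegrable_right (hW : 0 < W) (hT : 0 < T) {f : ℂ → ℂ}
    (hf : ContinuousOn f (rectBoundary W T)) :
    IntervalIntegrable (fun y : ℝ => f (W + y * Complex.I)) MeasureTheory.volume (-T) T :=
  ContinuousOn.intervalIntegrable <| hf.comp (by fun_prop) fun _ hx =>
    mem_rectBoundary_right hW (abs_le_of_mem_uIcc_neg hT hx)

lemma intervalIntegrable_left (hW : 0 < W) (hT : 0 < T) {f : ℂ → ℂ}
    (hf : ContinuousOn f (rectBoundary W T)) :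
    IntervalIntegrable (fun y : ℝ => f ((-W : ℝ) + y * Complex.I)) MeasureTheory.volume (-T) T :=
  ContinuousOn.intervalIntegrable <| hf.comp (by fun_prop) fun _ hx =>
    mem_rectBoundary_left hW (abs_le_of_mem_uIcc_neg hT hx)

lemma rectIntegral_add (hW : 0 < W) (hT : 0 < T) {f g : ℂ → ℂ}
    (hf : ContinuousOn f (rectBoundary W T)) (hg : ContinuousOn g (rectBoundary W T)) :
    rectIntegral W T (fun s => f s + g s) = rectIntegral W T f + rectIntegral W T g := by
  unfold rectIntegral
  rw [intervalIntegral.integral_add (intervalIntegrable_bottom hW hT hf)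
      (intervalIntegrable_bottom hW hT hg),
    intervalIntegral.integral_add (intervalIntegrable_top hW hT hf)
      (intervalIntegrable_top hW hT hg),
    intervalIntegral.integral_add (intervalIntegrable_right hW hT hf)
      (intervalIntegrable_right hW hT hg),
    intervalIntegral.integral_add (intervalIntegrable_left hW hT hf)
      (intervalIntegrable_left hW hT hg)]
  ring

lemma rectIntegral_const_mul (c : ℂ) (f : ℂ → ℂ) :
    rectIntegral W T (fun s => c * f s) = c * rectIntegral W T f := by
  unfold rectIntegral
  simp only [intervalIntegral.integral_const_mul]
  ring

lemma rectIntegral_sub (hW : 0 < W) (hT : 0 < T) {f g : ℂ → ℂ}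
    (hf : ContinuousOn f (rectBoundary W T)) (hg : ContinuousOn g (rectBoundary W T)) :
    rectIntegral W T (fun s => f s - g s) = rectIntegral W T f - rectIntegral W T g := by
  have := rectIntegral_add hW hT hf (g := fun s => -1 * g s) (hg.const_smul (-1 : ℂ))
  rw [rectIntegral_const_mul] at this
  rw [sub_eq_add_neg, ← neg_one_mul, ← this]
  exact congrArg _ (funext fun s => by ring)

lemma hasDerivAt_horizontal {F : ℂ → ℂ} {c : ℂ} {x t : ℝ}
    (h : HasDerivAt F c (x + t * Complex.I)) :
    HasDerivAt (fun x : ℝ => F (x + t * Complex.I)) c x := by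
  have h2 : HasDerivAt (fun x : ℝ => (x + t * Complex.I : ℂ)) 1 x :=
    (Complex.ofRealCLM.hasDerivAt (x := x)).add_const _
  have := h.comp x h2
  rwa [mul_one] at this

lemma hasDerivAt_vertical {F : ℂ → ℂ} {c : ℂ} {w y : ℝ}
    (h : HasDerivAt F c (w + y * Complex.I)) :
    HasDerivAt (fun y : ℝ => F (w + y * Complex.I)) (Complex.I * c) y := by
  have h2 : HasDerivAt (fun y : ℝ => (w + y * Complex.I : ℂ)) (1 * Complex.I) y :=
    ((Complex.ofRealCLM.hasDerivAt (x := y)).mul_const _).const_add _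
  have := h.comp y h2
  rwa [one_mul, mul_comm] at this

/-- The integral vanishes when the integrand has a primitive along the boundary. -/
lemma rectIntegral_eq_zero_of_hasDerivAt (hW : 0 < W) (hT : 0 < T) {f F : ℂ → ℂ}
    (hf : ContinuousOn f (rectBoundary W T))
    (hF : ∀ s ∈ rectBoundary W T, HasDerivAt F (f s) s) : rectIntegral W T f = 0 := by
  have hor : ∀ (t : ℝ), (∀ x : ℝ, |x| ≤ W → (x + t * Complex.I : ℂ) ∈ rectBoundary W T) →
      IntervalIntegrable (fun x : ℝ => f (x + t * Complex.I)) MeasureTheory.volume (-W) W →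
      ∫ x : ℝ in (-W)..W, f (x + t * Complex.I)
        = F (W + t * Complex.I) - F ((-W : ℝ) + t * Complex.I) := by
    intro t ht hi
    rw [intervalIntegral.integral_eq_sub_of_hasDerivAt
      (f := fun x : ℝ => F (x + t * Complex.I)) _ hi]
    intro x hx
    have h1 := hF _ (ht x (abs_le_of_mem_uIcc_neg hW hx))
    exact hasDerivAt_horizontal h1
  have ver : ∀ (w : ℝ), (∀ y : ℝ, |y| ≤ T → (w + y * Complex.I : ℂ) ∈ rectBoundary W T) →
      IntervalIntegrable (fun y : ℝ => f (w + y * Complex.I)) MeasureTheory.volume (-T) T →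
      Complex.I * ∫ y : ℝ in (-T)..T, f (w + y * Complex.I)
        = F (w + T * Complex.I) - F (w + (-T : ℝ) * Complex.I) := by
    intro w hw hi
    rw [← intervalIntegral.integral_const_mul,
      intervalIntegral.integral_eq_sub_of_hasDerivAt
      (f := fun y : ℝ => F (w + y * Complex.I)) _ (hi.const_mul _)]
    intro y hy
    have h1 := hF _ (hw y (abs_le_of_mem_uIcc_neg hT hy))
    exact hasDerivAt_vertical h1
  unfold rectIntegral
  rw [hor _ (fun x hx => mem_rectBoundary_bottom hT hx) (intervalIntegrable_bottom hW hT hf),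
    hor _ (fun x hx => mem_rectBoundary_top hT hx) (intervalIntegrable_top hW hT hf),
    ver _ (fun x hx => mem_rectBoundary_right hW hx) (intervalIntegrable_right hW hT hf),
    ver _ (fun x hx => mem_rectBoundary_left hW hx) (intervalIntegrable_left hW hT hf)]
  ring

lemma rectIntegral_eq_zero_of_differentiableAt (hW : 0 < W) (hT : 0 < T) {f : ℂ → ℂ}
    (hf : ∀ s : ℂ, |s.re| ≤ W → |s.im| ≤ T → DifferentiableAt ℂ f s) :
    rectIntegral W T f = 0 := by
  have := Complex.integral_boundary_rect_eq_zero_of_differentiableOn f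
    (⟨-W, -T⟩ : ℂ) (⟨W, T⟩ : ℂ) (fun s hs => by
      rw [Complex.mem_reProdIm] at hs
      exact (hf s (abs_le_of_mem_uIcc_neg hW hs.1)
        (abs_le_of_mem_uIcc_neg hT hs.2)).differentiableWithinAt)
  simpa [rectIntegral] using this

lemma ne_of_mem_rectBoundary {p s : ℂ} (hp : |p.re| < W) (hp' : |p.im| < T)
    (hs : s ∈ rectBoundary W T) : s ≠ p := by
  rintro rfl
  rcases hs with h | h <;> linarith [h.1, h.2]

lemma continuousOn_inv_sub {p : ℂ} (hp : |p.re| < W) (hp' : |p.im| < T) :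
    ContinuousOn (fun s => (s - p)⁻¹) (rectBoundary W T) :=
  ContinuousOn.inv₀ (by fun_prop) fun _ hs => sub_ne_zero.2 (ne_of_mem_rectBoundary hp hp' hs)

/-- The integral of a simple pole inside the rectangle. -/
lemma rectIntegral_inv_sub {p : ℂ} (hp : |p.re| < W) (hp' : |p.im| < T) :
    rectIntegral W T (fun s => (s - p)⁻¹) = 2 * π * Complex.I := by
  have hW : 0 < W := (abs_nonneg _).trans_lt hp
  have hT : 0 < T := (abs_nonneg _).trans_lt hp'
  have hc := continuousOn_inv_sub hp hp'
  rw [abs_lt] at hp hp'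
  have hlog : ∀ s : ℂ, s - p ∈ Complex.slitPlane →
      HasDerivAt (fun s => Complex.log (s - p)) (s - p)⁻¹ s := fun s hs => by
    simpa using ((hasDerivAt_id s).sub_const p).clog hs
  -- On the left side `s - p` crosses the branch cut of the logarithm, so `log (p - s)` serves as
  -- primitive there.
  have hlog' : ∀ s : ℂ, p - s ∈ Complex.slitPlane →
      HasDerivAt (fun s => Complex.log (p - s)) (s - p)⁻¹ s := fun s hs => by
    have := ((hasDerivAt_id s).const_sub p).clog hs
    rw [← neg_sub p s, inv_neg]
    simpa [neg_div] using this
  have hor : ∀ (t : ℝ), |t| = T →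
      IntervalIntegrable (fun x : ℝ => ((x + t * Complex.I : ℂ) - p)⁻¹)
        MeasureTheory.volume (-W) W →
      ∫ x : ℝ in (-W)..W, ((x + t * Complex.I : ℂ) - p)⁻¹
        = Complex.log (W + t * Complex.I - p) - Complex.log ((-W : ℝ) + t * Complex.I - p) := by
    intro t ht hi
    rw [intervalIntegral.integral_eq_sub_of_hasDerivAt
      (f := fun x : ℝ => Complex.log (x + t * Complex.I - p)) _ hi]
    intro x hx
    have h1 := hlog (x + t * Complex.I) (by
      rw [Complex.mem_slitPlane_iff]
      right
      rcases (abs_eq hT.le).1 ht with h | h <;> simp [h] <;> intro h' <;> linarith)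
    exact hasDerivAt_horizontal h1
  have ver : ∀ (w : ℝ) (F : ℂ → ℂ),
      (∀ y : ℝ, HasDerivAt F ((w + y * Complex.I : ℂ) - p)⁻¹ (w + y * Complex.I)) →
      IntervalIntegrable (fun y : ℝ => ((w + y * Complex.I : ℂ) - p)⁻¹)
        MeasureTheory.volume (-T) T →
      Complex.I * ∫ y : ℝ in (-T)..T, ((w + y * Complex.I : ℂ) - p)⁻¹
        = F (w + T * Complex.I) - F (w + (-T : ℝ) * Complex.I) := by
    intro w F hF hi
    rw [← intervalIntegral.integral_const_mul,
      intervalIntegral.integral_eq_sub_of_hasDerivAt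
      (f := fun y : ℝ => F (w + y * Complex.I)) _ (hi.const_mul _)]
    intro y _
    exact hasDerivAt_vertical (hF y)
  unfold rectIntegral
  rw [hor (-T) (by rw [abs_neg, abs_of_pos hT]) (intervalIntegrable_bottom hW hT hc),
    hor T (abs_of_pos hT) (intervalIntegrable_top hW hT hc),
    ver W (fun s => Complex.log (s - p)) (fun y => hlog _ (by
      rw [Complex.mem_slitPlane_iff]; left; simp; linarith)) (intervalIntegrable_right hW hT hc),
    ver (-W) (fun s => Complex.log (p - s)) (fun y => hlog' _ (by
      rw [Complex.mem_slitPlane_iff]; left; simp; linarith)) (intervalIntegrable_left hW hT hc)]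
  -- The two primitives differ by `πi` with opposite signs at the two left corners. These jumps add
  -- up to `2πi`, and all other logarithms cancel.
  have e1 : Complex.log (p - ((-W : ℝ) + T * Complex.I))
      = Complex.log ((-W : ℝ) + T * Complex.I - p) - π * Complex.I := by
    have : p - ((-W : ℝ) + T * Complex.I) = -((-W : ℝ) + T * Complex.I - p) := by ring
    rw [this, Complex.log, Complex.log, Complex.arg_neg_eq_arg_sub_pi_of_im_pos
      (by simp; linarith), norm_neg]
    push_cast; ring
  have e2 : Complex.log (p - ((-W : ℝ) + (-T : ℝ) * Complex.I))
      = Complex.log ((-W : ℝ) + (-T : ℝ) * Complex.I - p) + π * Complex.I := by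
    have : p - ((-W : ℝ) + (-T : ℝ) * Complex.I) = -((-W : ℝ) + (-T : ℝ) * Complex.I - p) := by
      ring
    rw [this, Complex.log, Complex.log, Complex.arg_neg_eq_arg_add_pi_of_im_neg
      (by simp; linarith), norm_neg]
    push_cast; ring
  rw [e1, e2]
  ring

/-- **Residue theorem** on a rectangle, for finitely many simple poles. -/
theorem rectIntegral_eq_sum_residues {κ : Type*} (A : Finset κ) (p r : κ → ℂ)
    (hW : 0 < W) (hT : 0 < T) (hinj : Set.InjOn p A)
    (hin : ∀ k ∈ A, |(p k).re| < W ∧ |(p k).im| < T) (f : ℂ → ℂ)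
    (hf : ∀ s : ℂ, |s.re| ≤ W → |s.im| ≤ T → (∀ k ∈ A, s ≠ p k) → DifferentiableAt ℂ f s)
    (hr : ∀ k ∈ A, Tendsto (fun s => (s - p k) * f s) (𝓝[≠] (p k)) (𝓝 (r k))) :
    rectIntegral W T f = 2 * π * Complex.I * ∑ k ∈ A, r k := by
  classical
  induction A using Finset.induction_on generalizing f with
  | empty =>
    simpa using rectIntegral_eq_zero_of_differentiableAt hW hT (f := f)
      fun s h1 h2 => hf s h1 h2 (by simp)
  | insert a A ha ih =>
    -- Multiplication by `s - p a`, with the residue filled in as value at `p a`, removes the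
    -- singularity. Then `dslope φ (p a)` is `f` minus its principal part at `p a`, which leaves
    -- only the poles in `A`.
    set φ : ℂ → ℂ := Function.update (fun s => (s - p a) * f s) (p a) (r a) with hφ
    have hφ_ne : ∀ s, s ≠ p a → φ s = (s - p a) * f s := fun s hs => by
      simp [hφ, Function.update_of_ne hs]
    have hφ_self : φ (p a) = r a := by simp [hφ]
    have hφ_ev : ∀ s, s ≠ p a → φ =ᶠ[𝓝 s] fun s => (s - p a) * f s := fun s hs => by
      filter_upwards [isOpen_ne.mem_nhds hs] with z hz using hφ_ne z hz
    have hφd : ∀ s : ℂ, |s.re| ≤ W → |s.im| ≤ T → s ≠ p a → (∀ k ∈ A, s ≠ p k) →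
        DifferentiableAt ℂ φ s := fun s h1 h2 h3 h4 => by
      refine DifferentiableAt.congr_of_eventuallyEq ?_ (hφ_ev s h3)
      have := hf s h1 h2 (by
        intro k hk
        rcases Finset.mem_insert.1 hk with rfl | hk
        exacts [h3, h4 k hk])
      fun_prop
    have hina := hin a (Finset.mem_insert_self _ _)
    have hAne : ∀ k ∈ A, p a ≠ p k := fun k hk h => by
      have := hinj (Finset.mem_coe.2 (Finset.mem_insert_self a A))
        (Finset.mem_coe.2 (Finset.mem_insert_of_mem hk)) h
      exact ha (this ▸ hk)
    have hφa : AnalyticAt ℂ φ (p a) := by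
      apply Complex.analyticAt_of_differentiable_on_punctured_nhds_of_continuousAt
      · have h1 : ∀ᶠ s in 𝓝 (p a), |s.re| < W :=
          (Complex.continuous_re.abs.continuousAt).eventually_lt continuousAt_const hina.1
        have h2 : ∀ᶠ s in 𝓝 (p a), |s.im| < T :=
          (Complex.continuous_im.abs.continuousAt).eventually_lt continuousAt_const hina.2
        have h3 : ∀ᶠ s in 𝓝 (p a), ∀ k ∈ A, s ≠ p k :=
          (A.eventually_all).2 fun k hk => isOpen_ne.mem_nhds (hAne k hk)
        filter_upwards [h1.filter_mono nhdsWithin_le_nhds, h2.filter_mono nhdsWithin_le_nhds,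
          h3.filter_mono nhdsWithin_le_nhds, self_mem_nhdsWithin] with s g1 g2 g3 g4
        exact hφd s g1.le g2.le g4 g3
      · rw [hφ, continuousAt_update_same]
        exact hr a (Finset.mem_insert_self _ _)
    set g : ℂ → ℂ := dslope φ (p a) with hg
    have hg_ne : ∀ s, s ≠ p a → g s = f s - r a * (s - p a)⁻¹ := fun s hs => by
      have : s - p a ≠ 0 := sub_ne_zero.2 hs
      rw [hg, dslope_of_ne _ hs, slope_def_field, hφ_ne s hs, hφ_self]
      field_simp
    have hgd : ∀ s : ℂ, |s.re| ≤ W → |s.im| ≤ T → (∀ k ∈ A, s ≠ p k) →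
        DifferentiableAt ℂ g s := fun s h1 h2 h4 => by
      by_cases h3 : s = p a
      · subst h3
        have h5 : ∀ᶠ s in 𝓝 (p a), DifferentiableAt ℂ φ s :=
          hφa.eventually_analyticAt.mono fun s hs => hs.differentiableAt
        have := (Complex.differentiableOn_dslope (f := φ) h5).2
          (fun z hz => DifferentiableAt.differentiableWithinAt hz)
        exact this.differentiableAt h5
      · have h5 : g =ᶠ[𝓝 s] fun s => f s - r a * (s - p a)⁻¹ := by
          filter_upwards [isOpen_ne.mem_nhds h3] with z hz using hg_ne z hz
        refine DifferentiableAt.congr_of_eventuallyEq ?_ h5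
        have h6 := hf s h1 h2 (by
          intro k hk
          rcases Finset.mem_insert.1 hk with rfl | hk
          exacts [h3, h4 k hk])
        have h7 : s - p a ≠ 0 := sub_ne_zero.2 h3
        fun_prop (disch := assumption)
    have key := ih (hinj.mono (by simp)) (fun k hk => hin k (Finset.mem_insert_of_mem hk)) g hgd
      (fun k hk => by
        have h1 := hr k (Finset.mem_insert_of_mem hk)
        have h2 : Tendsto (fun s => (s - p k) * (r a * (s - p a)⁻¹)) (𝓝[≠] (p k)) (𝓝 0) := by
          have : ContinuousAt (fun s => (s - p k) * (r a * (s - p a)⁻¹)) (p k) := by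
            have h7 : p k - p a ≠ 0 := sub_ne_zero.2 (hAne k hk).symm
            fun_prop (disch := assumption)
          simpa using this.tendsto.mono_left nhdsWithin_le_nhds
        have h3 := h1.sub h2
        rw [sub_zero] at h3
        refine h3.congr' ?_
        filter_upwards [nhdsWithin_le_nhds (isOpen_ne.mem_nhds (hAne k hk).symm)] with s hs
        rw [hg_ne s hs]
        ring)
    have hfc : ContinuousOn f (rectBoundary W T) := fun s hs =>
      (hf s (by rcases hs with h | h <;> linarith [h.1, h.2])
        (by rcases hs with h | h <;> linarith [h.1, h.2])
        (fun k hk => ne_of_mem_rectBoundary (hin k hk).1 (hin k hk).2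
          hs)).continuousAt.continuousWithinAt
    have hpc := continuousOn_inv_sub hina.1 hina.2
    rw [rectIntegral_congr hW hT (g := fun s => f s - r a * (s - p a)⁻¹) (fun s hs =>
      hg_ne s (ne_of_mem_rectBoundary hina.1 hina.2 hs)),
      rectIntegral_sub hW hT hfc (g := fun s => r a * (s - p a)⁻¹) (hpc.const_smul (r a)), rectIntegral_const_mul,
      rectIntegral_inv_sub hina.1 hina.2] at key
    rw [Finset.sum_insert ha, mul_add, ← key]
    ring

/-- A crude bound for the integral along the boundary of the rectangle. -/
lemma norm_rectIntegral_le (hW : 0 < W) (hT : 0 < T) {f : ℂ → ℂ} {A B : ℝ}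
    (hA : ∀ s : ℂ, |s.re| ≤ W → |s.im| = T → ‖f s‖ ≤ A)
    (hB : ∀ s : ℂ, |s.re| = W → |s.im| ≤ T → ‖f s‖ ≤ B) :
    ‖rectIntegral W T f‖ ≤ 4 * W * A + 4 * T * B := by
  have hor : ∀ t : ℝ, |t| = T → ‖∫ x : ℝ in (-W)..W, f (x + t * Complex.I)‖ ≤ 2 * W * A := by
    intro t ht
    have := intervalIntegral.norm_integral_le_of_norm_le_const (a := -W) (b := W)
      (f := fun x : ℝ => f (x + t * Complex.I)) (C := A) (fun x hx => hA _ (by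
        simpa using abs_le_of_mem_uIcc_neg hW (uIoc_subset_uIcc hx)) (by simpa using ht))
    rw [show W - -W = 2 * W by ring, abs_of_pos (by linarith)] at this
    linarith
  have ver : ∀ w : ℝ, |w| = W →
      ‖Complex.I * ∫ y : ℝ in (-T)..T, f (w + y * Complex.I)‖ ≤ 2 * T * B := by
    intro w hw
    have := intervalIntegral.norm_integral_le_of_norm_le_const (a := -T) (b := T)
      (f := fun y : ℝ => f (w + y * Complex.I)) (C := B) (fun x hx => hB _ (by
        simpa using hw) (by
        simpa using abs_le_of_mem_uIcc_neg hT (uIoc_subset_uIcc hx)))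
    rw [show T - -T = 2 * T by ring, abs_of_pos (by linarith)] at this
    rw [norm_mul, Complex.norm_I, one_mul]
    linarith
  unfold rectIntegral
  have h1 := hor (-T) (by rw [abs_neg, abs_of_pos hT])
  have h2 := hor T (abs_of_pos hT)
  have h3 := ver W (abs_of_pos hW)
  have h4 := ver (-W) (by rw [abs_neg, abs_of_pos hW])
  refine (norm_sub_le _ _).trans ?_
  refine (add_le_add_left ((norm_add_le _ _).trans
    (add_le_add_left (norm_sub_le _ _) _)) _).trans ?_
  linarith

/-! ### Perron's kernel and its bounds on the contour -/

/-- The product of the geometric series with the periods in `I`, in closed form. -/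
noncomputable def geomProd (I : List ℝ) (s : ℂ) : ℂ :=
  (I.map fun ℓ : ℝ => (1 - Complex.exp (-(s * ℓ)))⁻¹).prod

/-- The integrand of Perron's formula for the Dirichlet series `geomProd I` at height `exp y`. -/
noncomputable def perronKernel (I : List ℝ) (y : ℝ) (s : ℂ) : ℂ :=
  Complex.exp (s * y) / s * geomProd I s

/-- The normalized contour integral of Perron's kernel. -/
noncomputable def perronIntegral (I : List ℝ) (y R : ℝ) : ℂ :=
  (2 * π * Complex.I)⁻¹ * rectIntegral (√R) (2 * π * R) (perronKernel I y)

/-- Along `l`, the number `R * ℓ` keeps a distance from the integers. -/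
def AvoidsIntegers (l : Filter ℝ) (ℓ : ℝ) : Prop :=
  ∃ κ > 0, ∀ᶠ R in l, κ ≤ 1 - cos (2 * π * R * ℓ)

/-- The geometric series are bounded below on the contour with parameter `R`. -/
def ContourBound (I : List ℝ) (K R : ℝ) : Prop :=
  1 ≤ R ∧ ∀ s ∈ rectBoundary (√R) (2 * π * R), ∀ ℓ ∈ I,
    max 1 (exp (-(s.re * ℓ))) ≤ K * ‖1 - Complex.exp (-(s * ℓ))‖

/-- With `w = |exp (-z)|` one has `|1 - exp (-z)|² = (1 - w)² + 2w(1 - cos (im z))`, which dominates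
a multiple of `1 + w²`. This serves the horizontal sides. -/
lemma max_le_norm_of_cos {z : ℂ} {κ : ℝ} (hκ : 0 < κ) (h : κ ≤ 1 - cos z.im) :
    max 1 (exp (-z.re)) ≤ 2 / κ * ‖1 - Complex.exp (-z)‖ := by
  set w := exp (-z.re) with hw
  have hwpos : 0 < w := exp_pos _
  have hsq : ‖1 - Complex.exp (-z)‖ ^ 2 = 1 - 2 * w * cos z.im + w ^ 2 := by
    rw [Complex.sq_norm, Complex.normSq_apply]
    simp only [Complex.sub_re, Complex.one_re, Complex.exp_re, Complex.neg_re, Complex.neg_im,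
      Real.cos_neg, Complex.sub_im, Complex.one_im, Complex.exp_im, Real.sin_neg, ← hw]
    nlinarith [sin_sq_add_cos_sq z.im]
  have hκ2 : κ ≤ 2 := by linarith [neg_one_le_cos z.im]
  have h1 : κ / 2 * (1 + w ^ 2) ≤ ‖1 - Complex.exp (-z)‖ ^ 2 := by
    rw [hsq]
    nlinarith [mul_nonneg (show 0 ≤ 1 - κ / 2 by linarith) (sq_nonneg (1 - w)),
      mul_le_mul_of_nonneg_left h hwpos.le]
  have h2 : (max 1 w) ^ 2 ≤ 1 + w ^ 2 := by
    rcases max_choice 1 w with h | h <;> rw [h] <;> nlinarith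
  have h3 : (κ / 2 * max 1 w) ^ 2 ≤ ‖1 - Complex.exp (-z)‖ ^ 2 := by
    refine le_trans ?_ h1
    rw [mul_pow]
    calc (κ / 2) ^ 2 * max 1 w ^ 2 ≤ (κ / 2) * (1 + w ^ 2) := by
          apply mul_le_mul _ h2 (by positivity) (by positivity)
          nlinarith
      _ = _ := rfl
  have h4 := (le_abs_self _).trans (abs_le_of_sq_le_sq h3 (norm_nonneg _))
  rw [div_mul_eq_mul_div, le_div_iff₀ hκ]
  linarith

/-- Here `|exp (-z)|` is at most `1 / 2` or at least `2`, so the reverse triangle inequality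
suffices. This serves the vertical sides. -/
lemma max_le_norm_of_re {z : ℂ} (h : log 2 ≤ |z.re|) :
    max 1 (exp (-z.re)) ≤ 2 * ‖1 - Complex.exp (-z)‖ := by
  have hn : ‖Complex.exp (-z)‖ = exp (-z.re) := by rw [Complex.norm_exp, Complex.neg_re]
  have h1 := norm_sub_norm_le (1 : ℂ) (Complex.exp (-z))
  have h2 := norm_sub_norm_le (Complex.exp (-z)) (1 : ℂ)
  rw [norm_sub_rev] at h2
  rw [hn, norm_one] at h1 h2
  rcases le_abs.1 h with h | h
  · have : exp (-z.re) ≤ 1 / 2 := by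
      rw [exp_neg, ← one_div]
      exact one_div_le_one_div_of_le two_pos ((Real.log_le_iff_le_exp two_pos).1 h)
    exact max_le (by linarith) (by linarith)
  · have := (Real.log_le_iff_le_exp two_pos).1 h
    exact max_le (by linarith) (by linarith)

lemma exists_forall_avoids {l : Filter ℝ} {I : List ℝ} (hI : ∀ ℓ ∈ I, AvoidsIntegers l ℓ) :
    ∃ κ > 0, κ ≤ 1 ∧ ∀ᶠ R in l, ∀ ℓ ∈ I, κ ≤ 1 - cos (2 * π * R * ℓ) := by
  induction I with
  | nil => exact ⟨1, one_pos, le_rfl, by simp⟩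
  | cons a t ih =>
    obtain ⟨κ, h0, h1, h2⟩ := ih fun ℓ hℓ => hI ℓ (List.mem_cons_of_mem _ hℓ)
    obtain ⟨κ', h0', h2'⟩ := hI a List.mem_cons_self
    refine ⟨min κ κ', lt_min h0 h0', (min_le_left _ _).trans h1, ?_⟩
    filter_upwards [h2, h2'] with R g g' ℓ hℓ
    rcases List.mem_cons.1 hℓ with rfl | hℓ
    · exact (min_le_right _ _).trans g'
    · exact (min_le_left _ _).trans (g ℓ hℓ)

/-- On the horizontal sides `im (s * ℓ) = ±2πRℓ`, so the distance of `R * ℓ` from the integers gives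
the bound; on the vertical sides it is enough that `√R * ℓ` is eventually at least `log 2`. -/
lemma exists_contourBound {l : Filter ℝ} (hl : l ≤ atTop) {I : List ℝ} (hpos : ∀ ℓ ∈ I, 0 < ℓ)
    (hI : ∀ ℓ ∈ I, AvoidsIntegers l ℓ) : ∃ K > 0, ∀ᶠ R in l, ContourBound I K R := by
  obtain ⟨κ, h0, h1, h2⟩ := exists_forall_avoids hI
  refine ⟨2 / κ, by positivity, ?_⟩
  have hlarge : ∀ᶠ R in l, ∀ ℓ ∈ I, log 2 ≤ √R * ℓ := by
    have : ∀ ℓ ∈ I, ∀ᶠ R in l, log 2 ≤ √R * ℓ := fun ℓ hℓ =>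
      hl ((tendsto_sqrt_atTop.atTop_mul_const (hpos ℓ hℓ)).eventually_ge_atTop (log 2))
    simpa using (I.toFinset.eventually_all (l := l) (p := fun ℓ R => log 2 ≤ √R * ℓ)).2
      (by simpa using this)
  filter_upwards [h2, hlarge, hl (eventually_ge_atTop 1)] with R g1 g2 g3
  refine ⟨g3, fun s hs ℓ hℓ => ?_⟩
  have hre : (s * ℓ).re = s.re * ℓ := by simp
  have him : (s * ℓ).im = s.im * ℓ := by simp
  rw [← hre]
  rcases hs with hs | hs
  · apply max_le_norm_of_cos h0
    rw [him]
    have : cos (s.im * ℓ) = cos (2 * π * R * ℓ) := by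
      rw [← hs.2]
      rcases abs_choice s.im with h | h <;> rw [h]
      rw [neg_mul, Real.cos_neg]
    rw [this]
    exact g1 ℓ hℓ
  · refine (max_le_norm_of_re ?_).trans ?_
    · rw [hre, abs_mul, hs.1, abs_of_pos (hpos ℓ hℓ)]
      exact g2 ℓ hℓ
    -- Because `κ ≤ 1`, the constant `2 / κ` also covers the constant `2` of the vertical sides.
    · refine mul_le_mul_of_nonneg_right ?_ (norm_nonneg _)
      rw [le_div_iff₀ h0]
      linarith

section

variable {I : List ℝ} {K R : ℝ}

lemma ContourBound.sqrt_pos (h : ContourBound I K R) : 0 < √R :=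
  Real.sqrt_pos.2 (one_pos.trans_le h.1)

lemma ContourBound.height_pos (h : ContourBound I K R) : 0 < 2 * π * R := by
  have := h.1
  positivity

lemma ContourBound.ne_zero (h : ContourBound I K R) {s : ℂ}
    (hs : s ∈ rectBoundary (√R) (2 * π * R)) : s ≠ 0 :=
  ne_of_mem_rectBoundary (by simpa using h.sqrt_pos) (by simpa using h.height_pos) hs

lemma ContourBound.factor_ne_zero (h : ContourBound I K R) {s : ℂ}
    (hs : s ∈ rectBoundary (√R) (2 * π * R)) {ℓ : ℝ} (hℓ : ℓ ∈ I) :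
    1 - Complex.exp (-(s * ℓ)) ≠ 0 := fun h0 => by
  have := h.2 s hs ℓ hℓ
  rw [h0, norm_zero, mul_zero] at this
  linarith [le_max_left 1 (exp (-(s.re * ℓ)))]

lemma ContourBound.mono {I' : List ℝ} (h : ContourBound I K R) (hI : ∀ ℓ ∈ I', ℓ ∈ I) :
    ContourBound I' K R :=
  ⟨h.1, fun s hs ℓ hℓ => h.2 s hs ℓ (hI ℓ hℓ)⟩

lemma continuousAt_geomProd {s : ℂ} (h : ∀ ℓ ∈ I, 1 - Complex.exp (-(s * (ℓ : ℝ))) ≠ 0) :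
    ContinuousAt (geomProd I) s := by
  induction I with
  | nil => exact continuousAt_const
  | cons a t ih =>
    have h1 := ih fun ℓ hℓ => h ℓ (List.mem_cons_of_mem _ hℓ)
    have h2 := h a List.mem_cons_self
    have h3 : ContinuousAt (fun s : ℂ => (1 - Complex.exp (-(s * a)))⁻¹) s := by
      fun_prop (disch := assumption)
    have e : geomProd (a :: t) = fun s => (1 - Complex.exp (-(s * a)))⁻¹ * geomProd t s := by
      ext s; simp [geomProd]
    rw [e]
    exact h3.mul h1

lemma ContourBound.continuousOn (h : ContourBound I K R) (y : ℝ) :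
    ContinuousOn (perronKernel I y) (rectBoundary (√R) (2 * π * R)) := fun s hs => by
  have h1 := continuousAt_geomProd fun ℓ hℓ => h.factor_ne_zero hs hℓ
  have h2 := h.ne_zero hs
  have h3 : ContinuousAt (fun s : ℂ => Complex.exp (s * y) / s) s := by
    fun_prop (disch := assumption)
  exact (h3.mul h1).continuousWithinAt

/-- The two entries of the maximum give two bounds for each factor: the constant one is used in the
right half-plane, the one with `exp (s.re * ℓ)` in the left half-plane. -/
lemma norm_geomProd_le {s : ℂ} (hK : 0 ≤ K)
    (h : ∀ ℓ ∈ I, max 1 (exp (-(s.re * ℓ))) ≤ K * ‖1 - Complex.exp (-(s * (ℓ : ℝ)))‖) :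
    ‖geomProd I s‖ ≤ K ^ I.length ∧ ‖geomProd I s‖ ≤ K ^ I.length * exp (s.re * I.sum) := by
  induction I with
  | nil => simp [geomProd]
  | cons a t ih =>
    obtain ⟨h1, h2⟩ := ih fun ℓ hℓ => h ℓ (List.mem_cons_of_mem _ hℓ)
    have h3 := h a List.mem_cons_self
    have h4 := (le_max_left _ _).trans h3
    have h5 := (le_max_right _ _).trans h3
    have hp : 0 < ‖1 - Complex.exp (-(s * (a : ℝ)))‖ := by
      by_contra h0
      have : ‖1 - Complex.exp (-(s * (a : ℝ)))‖ = 0 := le_antisymm (not_lt.1 h0) (norm_nonneg _)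
      rw [this, mul_zero] at h4
      linarith
    have e : ‖geomProd (a :: t) s‖ = ‖1 - Complex.exp (-(s * (a : ℝ)))‖⁻¹ * ‖geomProd t s‖ := by
      simp [geomProd]
    have i1 : ‖1 - Complex.exp (-(s * (a : ℝ)))‖⁻¹ ≤ K := by
      rw [inv_le_iff_one_le_mul₀ hp]; exact h4
    have i2 : ‖1 - Complex.exp (-(s * (a : ℝ)))‖⁻¹ ≤ K * exp (s.re * a) := by
      rw [inv_le_iff_one_le_mul₀ hp]
      rw [exp_neg, inv_le_iff_one_le_mul₀ (exp_pos _)] at h5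
      linarith
    rw [e, List.length_cons, List.sum_cons, pow_succ', mul_add, exp_add]
    constructor
    · exact mul_le_mul i1 h1 (norm_nonneg _) hK
    · calc _ ≤ (K * exp (s.re * a)) * (K ^ t.length * exp (s.re * t.sum)) :=
            mul_le_mul i2 h2 (norm_nonneg _) (by positivity)
        _ = _ := by ring

/-- To the right `exp (s.re * y)` decays because `y ≤ -ε`; to the left the geometric factors
contribute `exp (s.re * I.sum)`, and `y + I.sum ≥ ε` makes the product decay. -/
lemma ContourBound.norm_perronKernel_le (h : ContourBound I K R) (hK : 0 ≤ K) {y ε : ℝ}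
    (hy : ε ≤ -y) (hy' : ε ≤ y + I.sum) {s : ℂ} (hs : s ∈ rectBoundary (√R) (2 * π * R)) :
    ‖perronKernel I y s‖ ≤ K ^ I.length * exp (-(ε * |s.re|)) / ‖s‖ := by
  obtain ⟨h1, h2⟩ := norm_geomProd_le hK fun ℓ hℓ => h.2 s hs ℓ hℓ
  have e : ‖perronKernel I y s‖ = exp (s.re * y) * ‖geomProd I s‖ / ‖s‖ := by
    rw [perronKernel, norm_mul, norm_div, Complex.norm_exp]
    simp only [Complex.mul_re, Complex.ofReal_re, Complex.ofReal_im, mul_zero, sub_zero]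
    ring
  rw [e]
  apply div_le_div_of_nonneg_right _ (norm_nonneg _)
  rcases le_total 0 s.re with h0 | h0
  · rw [abs_of_nonneg h0, mul_comm]
    apply mul_le_mul h1 _ (exp_pos _).le (by positivity)
    apply exp_le_exp.2
    nlinarith
  · rw [abs_of_nonpos h0]
    calc _ ≤ exp (s.re * y) * (K ^ I.length * exp (s.re * I.sum)) :=
          mul_le_mul_of_nonneg_left h2 (exp_pos _).le
      _ = K ^ I.length * exp (s.re * (y + I.sum)) := by rw [mul_add, exp_add]; ring
      _ ≤ _ := by
          apply mul_le_mul_of_nonneg_left _ (by positivity)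
          apply exp_le_exp.2
          nlinarith

end

/-- The half-width `√R` balances the sides: the horizontal ones have length of order `√R` and
integrand `O(1 / R)`, while the vertical ones have length of order `R` but integrand `O(exp
(-ε√R))`. -/
lemma tendsto_perronIntegral_zero {l : Filter ℝ} (hl : l ≤ atTop) {I : List ℝ}
    (hpos : ∀ ℓ ∈ I, 0 < ℓ) (hI : ∀ ℓ ∈ I, AvoidsIntegers l ℓ) {y : ℝ} (hy : y < 0)
    (hy' : -I.sum < y) : Tendsto (perronIntegral I y) l (𝓝 0) := by
  obtain ⟨K, hK, hev⟩ := exists_contourBound hl hpos hI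
  set ε := min (-y) (y + I.sum) with hε
  have hε0 : 0 < ε := lt_min (by linarith) (by linarith)
  suffices h : Tendsto (fun R => rectIntegral (√R) (2 * π * R) (perronKernel I y)) l (𝓝 0) by
    have := h.const_mul (2 * π * Complex.I : ℂ)⁻¹
    rwa [mul_zero] at this
  have hlim : Tendsto (fun R : ℝ => 2 * K ^ I.length / π * (√R)⁻¹
      + 8 * π * K ^ I.length * (√R ^ (1 : ℝ) * exp (-ε * √R))) l (𝓝 0) := by
    refine Tendsto.mono_left ?_ hl
    have h1 := (tendsto_inv_atTop_zero.comp tendsto_sqrt_atTop).const_mul (2 * K ^ I.length / π)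
    have h2 := ((tendsto_rpow_mul_exp_neg_mul_atTop_nhds_zero 1 ε hε0).comp
      tendsto_sqrt_atTop).const_mul (8 * π * K ^ I.length)
    simpa using h1.add h2
  refine squeeze_zero_norm' ?_ hlim
  filter_upwards [hev] with R hR
  have hW := hR.sqrt_pos
  have hT := hR.height_pos
  have hRpos : 0 < R := one_pos.trans_le hR.1
  have hbound := norm_rectIntegral_le hW hT (f := perronKernel I y)
    (A := K ^ I.length / (2 * π * R)) (B := K ^ I.length * exp (-(ε * √R)) / √R)
    (fun s h1 h2 => by
      refine (hR.norm_perronKernel_le hK.le (min_le_left _ _) (min_le_right _ _)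
        (Or.inl ⟨h1, h2⟩)).trans ?_
      apply div_le_div₀ (by positivity) _ hT (h2 ▸ Complex.abs_im_le_norm s)
      refine mul_le_of_le_one_right (by positivity) (exp_le_one_iff.2 ?_)
      have := mul_nonneg hε0.le (abs_nonneg s.re)
      linarith)
    (fun s h1 h2 => by
      refine (hR.norm_perronKernel_le hK.le (min_le_left _ _) (min_le_right _ _)
        (Or.inr ⟨h1, h2⟩)).trans ?_
      rw [h1]
      exact div_le_div_of_nonneg_left (by positivity) hW (h1 ▸ Complex.abs_re_le_norm s))
  refine hbound.trans (le_of_eq ?_)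
  have hsq : R = √R * √R := (Real.mul_self_sqrt hRpos.le).symm
  rw [Real.rpow_one, neg_mul]
  generalize √R = r at *
  subst hsq
  field_simp
  ring

/-! ### Weighted lattice point counts and Perron's formula -/

/-- The Heaviside function with the value `1 / 2` at the jump. -/
noncomputable def stepHalf (y : ℝ) : ℝ := if y < 0 then 0 else if y = 0 then 1 / 2 else 1

/-- The number of `ℕ`-combinations of the entries of the list that are at most `y`, with weight
`1 / 2` for those that are equal to `y`. -/
noncomputable def latticeCount : List ℝ → ℝ → ℝ
  | [] => stepHalf
  | ℓ :: t => fun y => ∑' n : ℕ, latticeCount t (y - n * ℓ)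

lemma latticeCount_of_neg {I : List ℝ} (hpos : ∀ ℓ ∈ I, 0 < ℓ) {y : ℝ} (hy : y < 0) :
    latticeCount I y = 0 := by
  induction I generalizing y with
  | nil => simp [latticeCount, stepHalf, hy]
  | cons a t ih =>
    rw [latticeCount]
    refine (tsum_congr fun n => ih (fun ℓ hℓ => hpos ℓ (List.mem_cons_of_mem _ hℓ)) ?_).trans
      tsum_zero
    have := hpos a List.mem_cons_self
    have : 0 ≤ (n : ℝ) * a := by positivity
    linarith

lemma latticeCount_eq_zero_of_lt {a : ℝ} {t : List ℝ} (hpos : ∀ ℓ ∈ a :: t, 0 < ℓ) {y : ℝ}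
    {M : ℕ} (hM : y < M * a) {n : ℕ} (hn : n ∉ Finset.range M) :
    latticeCount t (y - n * a) = 0 := by
  refine latticeCount_of_neg (fun ℓ hℓ => hpos ℓ (List.mem_cons_of_mem _ hℓ)) ?_
  have ha := hpos a List.mem_cons_self
  have : (M : ℝ) ≤ n := by exact_mod_cast not_lt.1 fun h => hn (Finset.mem_range.2 h)
  nlinarith

/-- Splitting off the term `n = 0` of the sum. This is the recursion that the contour integrals
satisfy in `ContourBound.perronIntegral_cons`. -/
lemma latticeCount_cons {a : ℝ} {t : List ℝ} (hpos : ∀ ℓ ∈ a :: t, 0 < ℓ) (y : ℝ) :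
    latticeCount (a :: t) y = latticeCount (a :: t) (y - a) + latticeCount t y := by
  have ha := hpos a List.mem_cons_self
  obtain ⟨M, hM⟩ := exists_nat_gt (y / a)
  rw [div_lt_iff₀ ha] at hM
  have hs : Summable fun n : ℕ => latticeCount t (y - n * a) :=
    summable_of_ne_finset_zero (s := Finset.range M) fun n hn =>
      latticeCount_eq_zero_of_lt hpos hM hn
  simp only [latticeCount]
  rw [hs.tsum_eq_zero_add, add_comm]
  congr 1
  · refine tsum_congr fun n => congrArg _ ?_
    push_cast
    ring
  · simp

/-- Without periods the only pole is the origin, with residue `1` whatever the sign of `y`. Hence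
the empty list obeys Perron's formula only for `y > 0`. -/
lemma perronIntegral_nil {y R : ℝ} (hR : 1 ≤ R) : perronIntegral [] y R = 1 := by
  have hW : 0 < √R := Real.sqrt_pos.2 (one_pos.trans_le hR)
  have hT : 0 < 2 * π * R := by positivity
  have := rectIntegral_eq_sum_residues {()} (fun _ => (0 : ℂ)) (fun _ => 1) hW hT (by simp)
    (fun _ _ => ⟨by simpa using hW, by simpa using hT⟩) (perronKernel [] y)
    (fun s _ _ hs => by
      have h0 : s ≠ 0 := by simpa using hs
      have : perronKernel [] y = fun s : ℂ => Complex.exp (s * y) / s := by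
        ext s; simp [perronKernel, geomProd]
      rw [this]
      fun_prop (disch := assumption))
    (fun _ _ => by
      have h1 : Tendsto (fun s : ℂ => Complex.exp (s * y)) (𝓝[≠] 0) (𝓝 1) := by
        have : Continuous fun s : ℂ => Complex.exp (s * y) := by fun_prop
        simpa using (this.tendsto 0).mono_left nhdsWithin_le_nhds
      refine h1.congr' ?_
      filter_upwards [self_mem_nhdsWithin] with s hs
      have : s ≠ 0 := hs
      simp only [perronKernel, geomProd, List.map_nil, List.prod_nil]
      field_simp
      ring)
  rw [perronIntegral, this]
  simp only [Finset.sum_const, Finset.card_singleton, one_smul, mul_one]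
  exact inv_mul_cancel₀ Complex.two_pi_I_ne_zero

lemma rectIntegral_comp_neg (W T : ℝ) (f : ℂ → ℂ) :
    rectIntegral W T (fun s => f (-s)) = -rectIntegral W T f := by
  have hor : ∀ t : ℝ, ∫ x : ℝ in (-W)..W, f (-(x + t * Complex.I))
      = ∫ x : ℝ in (-W)..W, f (x + (-t : ℝ) * Complex.I) := fun t => by
    have := intervalIntegral.integral_comp_neg (a := -W) (b := W)
      (fun x : ℝ => f (x + (-t : ℝ) * Complex.I))
    rw [neg_neg] at this
    rw [← this]
    congr 1; ext x; congr 1; push_cast; ring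
  have ver : ∀ w : ℝ, ∫ y : ℝ in (-T)..T, f (-(w + y * Complex.I))
      = ∫ y : ℝ in (-T)..T, f ((-w : ℝ) + y * Complex.I) := fun w => by
    have := intervalIntegral.integral_comp_neg (a := -T) (b := T)
      (fun y : ℝ => f ((-w : ℝ) + y * Complex.I))
    rw [neg_neg] at this
    rw [← this]
    congr 1; ext x; congr 1; push_cast; ring
  simp only [rectIntegral, hor, ver, neg_neg]
  ring

/-- From `1 / (1 - exp (-w)) + 1 / (1 - exp w) = 1` the kernel `k` at `y = 0` satisfies `k (-s) = k
s - 1 / s`. The substitution `s ↦ -s` changes the sign of the integral, so twice the integral is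
`2πi`. This is the source of the weight `1 / 2`. -/
lemma ContourBound.perronIntegral_singleton_zero {a K R : ℝ} (h : ContourBound [a] K R) :
    perronIntegral [a] 0 R = 1 / 2 := by
  have h1 := rectIntegral_comp_neg (√R) (2 * π * R) (perronKernel [a] 0)
  rw [rectIntegral_congr h.sqrt_pos h.height_pos
    (g := fun s => perronKernel [a] 0 s - (s - 0)⁻¹) (fun s hs => by
      have e1 := h.ne_zero hs
      have e2 := h.factor_ne_zero hs (ℓ := a) (by simp)
      have e3 : 1 - Complex.exp (s * a) ≠ 0 := by
        intro h0
        apply e2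
        rw [Complex.exp_neg, ← sub_eq_zero.1 h0, inv_one, sub_self]
      simp only [perronKernel, geomProd, List.map_cons, List.map_nil, List.prod_cons,
        List.prod_nil, mul_one, Complex.ofReal_zero, mul_zero, neg_mul, neg_neg, sub_zero]
      rw [Complex.exp_neg] at e2 ⊢
      have e4 := Complex.exp_ne_zero (s * a)
      have e5 : Complex.exp (s * a) - 1 ≠ 0 := fun h => e3 (by rw [← neg_sub, h, neg_zero])
      have e6 : 1 - (Complex.exp (s * a))⁻¹ = (Complex.exp (s * a) - 1) / Complex.exp (s * a) := by
        field_simp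
      rw [e6, ← neg_sub (Complex.exp (s * a)) 1]
      simp only [Complex.exp_zero]
      field_simp
      ring),
    rectIntegral_sub h.sqrt_pos h.height_pos (h.continuousOn 0)
      (continuousOn_inv_sub (by simpa using h.sqrt_pos) (by simpa using h.height_pos)),
    rectIntegral_inv_sub (by simpa using h.sqrt_pos) (by simpa using h.height_pos)] at h1
  have h2 : rectIntegral (√R) (2 * π * R) (perronKernel [a] 0) = (2 * π * Complex.I) * (1 / 2) := by
    linear_combination h1 / 2
  rw [perronIntegral, h2, inv_mul_cancel_left₀ Complex.two_pi_I_ne_zero]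

/-- Since `exp (s * y) - exp (s * (y - a)) = exp (s * y) * (1 - exp (-s * a))`, the difference of
the kernels loses the factor belonging to `a`. -/
lemma ContourBound.perronIntegral_cons {a K R : ℝ} {t : List ℝ} (h : ContourBound (a :: t) K R)
    (y : ℝ) :
    perronIntegral (a :: t) y R = perronIntegral (a :: t) (y - a) R + perronIntegral t y R := by
  have ht : ContourBound t K R := h.mono fun ℓ hℓ => List.mem_cons_of_mem _ hℓ
  unfold perronIntegral
  rw [← mul_add, ← rectIntegral_add h.sqrt_pos h.height_pos (h.continuousOn _)
    (ht.continuousOn _)]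
  refine congrArg _ (rectIntegral_congr h.sqrt_pos h.height_pos fun s hs => ?_)
  have e1 := h.ne_zero hs
  have e2 := h.factor_ne_zero hs (ℓ := a) (by simp)
  have e3 : Complex.exp (s * (y - a : ℝ)) = Complex.exp (s * y) * Complex.exp (-(s * a)) := by
    rw [← Complex.exp_add]
    congr 1
    push_cast
    ring
  simp only [perronKernel, e3, geomProd, List.map_cons, List.prod_cons]
  field_simp
  ring

/-- **Perron's formula**: the contour integrals converge to the weighted lattice point count. -/
theorem tendsto_perronIntegral {l : Filter ℝ} (hl : l ≤ atTop) {I : List ℝ} (hne : I ≠ [])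
    (hpos : ∀ ℓ ∈ I, 0 < ℓ) (hI : ∀ ℓ ∈ I, AvoidsIntegers l ℓ) {y : ℝ} (hy : -I.sum < y) :
    Tendsto (perronIntegral I y) l (𝓝 (latticeCount I y : ℂ)) := by
  induction I generalizing y with
  | nil => exact absurd rfl hne
  | cons a t ih =>
    obtain ⟨K, -, hev⟩ := exists_contourBound hl hpos hI
    have ha := hpos a List.mem_cons_self
    have htpos : ∀ ℓ ∈ t, 0 < ℓ := fun ℓ hℓ => hpos ℓ (List.mem_cons_of_mem _ hℓ)
    have hsum : 0 ≤ t.sum := List.sum_nonneg fun ℓ hℓ => (htpos ℓ hℓ).le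
    have hneg : ∀ y < 0, -(a :: t).sum < y →
        Tendsto (perronIntegral (a :: t) y) l (𝓝 (latticeCount (a :: t) y : ℂ)) := by
      intro y h1 h2
      rw [latticeCount_of_neg hpos h1]
      simpa using tendsto_perronIntegral_zero hl hpos hI h1 h2
    have hstep : ∀ y : ℝ, Tendsto (perronIntegral t y) l (𝓝 (latticeCount t y : ℂ)) →
        Tendsto (perronIntegral (a :: t) (y - a)) l (𝓝 (latticeCount (a :: t) (y - a) : ℂ)) →
        Tendsto (perronIntegral (a :: t) y) l (𝓝 (latticeCount (a :: t) y : ℂ)) := by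
      intro y h1 h2
      rw [latticeCount_cons hpos y, Complex.ofReal_add]
      refine (h2.add h1).congr' ?_
      filter_upwards [hev] with R hR
      rw [hR.perronIntegral_cons y]
    -- Each step lowers `y` by one period `a`, until the negative range covered by `hneg` is
    -- reached.
    have main : ∀ m : ℕ, ∀ y : ℝ, -(a :: t).sum < y → y < m * a →
        Tendsto (perronIntegral (a :: t) y) l (𝓝 (latticeCount (a :: t) y : ℂ)) := by
      intro m
      induction m with
      | zero => intro y h1 h2; exact hneg y (by simpa using h2) h1
      | succ m ihm =>
        intro y h1 h2
        rcases lt_or_ge y 0 with h0 | h0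
        · exact hneg y h0 h1
        have h3 : y - a < m * a := by push_cast at h2; linarith
        -- For a single period and `y = 0` the shifted point `-a` is the excluded endpoint of the
        -- range and the empty list gives the wrong value, so this case rests on the symmetry
        -- argument.
        rcases eq_or_ne t [] with rfl | htne
        · rcases h0.eq_or_lt with h0 | h0
          · subst h0
            have e : latticeCount [a] 0 = 1 / 2 := by
              rw [latticeCount_cons hpos, latticeCount_of_neg hpos (by linarith)]
              simp [latticeCount, stepHalf]
            rw [e]
            refine tendsto_const_nhds.congr' ?_
            filter_upwards [hev] with R hR
            rw [hR.perronIntegral_singleton_zero]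
            norm_num
          · refine hstep y ?_ (ihm _ (by simp; linarith) h3)
            have e : latticeCount [] y = 1 := by
              simp [latticeCount, stepHalf, h0.not_gt, h0.ne']
            rw [e]
            refine tendsto_const_nhds.congr' ?_
            filter_upwards [hev] with R hR
            rw [perronIntegral_nil hR.1]
            norm_num
        · have hsum' : 0 < t.sum := List.sum_pos _ htpos htne
          exact hstep y (ih htne htpos (fun ℓ hℓ => hI ℓ (List.mem_cons_of_mem _ hℓ))
            (by linarith)) (ihm _ (by simp; linarith) h3)
    obtain ⟨m, hm⟩ := exists_nat_gt (y / a)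
    exact main m y hy ((div_lt_iff₀ ha).1 hm)

/-! ### Taylor expansions at the origin -/

/-- `g` has the Taylor coefficients `a 0, …, a 4` at the origin, up to an error of order five. -/
def HasTaylor (g : ℂ → ℂ) (a : ℕ → ℂ) : Prop :=
  (fun s => g s - ∑ j ∈ Finset.range 5, a j * s ^ j) =O[𝓝[≠] (0 : ℂ)] fun s => s ^ 5

/-- The Cauchy product of two sequences of coefficients. -/
def cauchyProd (a b : ℕ → ℂ) (n : ℕ) : ℂ := ∑ i ∈ Finset.range (n + 1), a i * b (n - i)

lemma isBigO_one_of_continuous {g : ℂ → ℂ} (hg : Continuous g) :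
    g =O[𝓝[≠] (0 : ℂ)] fun _ => (1 : ℂ) :=
  ((hg.tendsto 0).isBigO_one ℂ).mono nhdsWithin_le_nhds

lemma HasTaylor.isBigO_one {g : ℂ → ℂ} {a : ℕ → ℂ} (hg : HasTaylor g a) :
    g =O[𝓝[≠] (0 : ℂ)] fun _ => (1 : ℂ) := by
  have h1 : (fun s : ℂ => s ^ 5) =O[𝓝[≠] (0 : ℂ)] fun _ => (1 : ℂ) :=
    isBigO_one_of_continuous (by fun_prop)
  have h2 : (fun s : ℂ => ∑ j ∈ Finset.range 5, a j * s ^ j) =O[𝓝[≠] (0 : ℂ)] fun _ => (1 : ℂ) :=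
    isBigO_one_of_continuous (by fun_prop)
  simpa using (Asymptotics.IsBigO.trans hg h1).add h2

lemma HasTaylor.mul {g h : ℂ → ℂ} {a b : ℕ → ℂ} (hg : HasTaylor g a) (hh : HasTaylor h b) :
    HasTaylor (fun s => g s * h s) (cauchyProd a b) := by
  have h1 := Asymptotics.IsBigO.mul hg hh.isBigO_one
  have h2 := (isBigO_one_of_continuous
    (g := fun s : ℂ => ∑ j ∈ Finset.range 5, a j * s ^ j) (by fun_prop)).mul hh
  -- The part of degree at least five in the product of the two Taylor polynomials, divided by `s ^
  -- 5`.
  have h3 := (isBigO_one_of_continuous (g := fun s : ℂ =>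
    (a 1 * b 4 + a 2 * b 3 + a 3 * b 2 + a 4 * b 1) + (a 2 * b 4 + a 3 * b 3 + a 4 * b 2) * s
      + (a 3 * b 4 + a 4 * b 3) * s ^ 2 + a 4 * b 4 * s ^ 3) (by fun_prop)).mul
    (Asymptotics.isBigO_refl (fun s : ℂ => s ^ 5) (𝓝[≠] 0))
  simp only [mul_one, one_mul] at h1 h2 h3
  refine ((h1.add h2).add h3).congr_left fun s => ?_
  simp only [cauchyProd, Finset.sum_range_succ, Finset.sum_range_zero, Nat.reduceSub, zero_add]
  ring

lemma HasTaylor.exists_prod {ι : Type*} (A : Finset ι) {g : ι → ℂ → ℂ}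
    (hg : ∀ i ∈ A, ∃ a, HasTaylor (g i) a) : ∃ a, HasTaylor (fun s => ∏ i ∈ A, g i s) a := by
  classical
  induction A using Finset.induction_on with
  | empty =>
    refine ⟨fun j => if j = 0 then 1 else 0, ?_⟩
    simp [HasTaylor, Asymptotics.isBigO_zero]
  | insert i A hi ih =>
    obtain ⟨a, ha⟩ := hg i (Finset.mem_insert_self _ _)
    obtain ⟨b, hb⟩ := ih fun j hj => hg j (Finset.mem_insert_of_mem hj)
    refine ⟨cauchyProd a b, ?_⟩
    simpa only [Finset.prod_insert hi] using ha.mul hb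

/-- With `n` periods and `g` the product of the exponential and the Todd factors, this quotient is,
up to the product of the periods, `s` times the kernel without its poles of order at least two. The
limit is thus the residue at the origin. -/
lemma HasTaylor.tendsto_coeff {g : ℂ → ℂ} {a : ℕ → ℂ} (hg : HasTaylor g a) {n : ℕ} (hn : n ≤ 4) :
    Tendsto (fun s => (g s - ∑ j ∈ Finset.range n, a j * s ^ j) / s ^ n) (𝓝[≠] 0)
      (𝓝 (a n)) := by
  have h1 : (fun s => g s - ∑ j ∈ Finset.range 5, a j * s ^ j) =o[𝓝[≠] (0 : ℂ)]
      fun s => s ^ n :=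
    Asymptotics.IsBigO.trans_isLittleO hg
      ((Asymptotics.isLittleO_pow_pow (by omega)).mono nhdsWithin_le_nhds)
  have h2 : Tendsto (fun s : ℂ => ∑ j ∈ Finset.range (4 - n + 1), a (n + j) * s ^ j) (𝓝[≠] 0)
      (𝓝 (a n)) := by
    have : Continuous fun s : ℂ => ∑ j ∈ Finset.range (4 - n + 1), a (n + j) * s ^ j := by
      fun_prop
    simpa [Finset.sum_range_succ'] using (this.tendsto 0).mono_left nhdsWithin_le_nhds
  have h3 := h1.tendsto_div_nhds_zero.add h2
  rw [zero_add] at h3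
  refine h3.congr' ?_
  filter_upwards [self_mem_nhdsWithin] with s hs
  have hs : s ≠ 0 := hs
  rw [show 5 = n + (4 - n + 1) by omega, Finset.sum_range_add,
    div_add' _ _ _ (pow_ne_zero _ hs), Finset.sum_mul]
  congr 1
  have : ∑ i ∈ Finset.range (4 - n + 1), a (n + i) * s ^ i * s ^ n
      = ∑ i ∈ Finset.range (4 - n + 1), a (n + i) * s ^ (n + i) :=
    Finset.sum_congr rfl fun i _ => by rw [pow_add]; ring
  rw [this]
  ring

/-- The Taylor coefficients of `exp (s * y)`. -/
noncomputable def expCoeff (y : ℂ) (j : ℕ) : ℂ := y ^ j / j.factorial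

lemma hasTaylor_exp (y : ℂ) : HasTaylor (fun s => Complex.exp (s * y)) (expCoeff y) := by
  have h : Tendsto (fun s : ℂ => s * y) (𝓝[≠] 0) (𝓝 0) := by
    have : Continuous fun s : ℂ => s * y := by fun_prop
    simpa using (this.tendsto 0).mono_left nhdsWithin_le_nhds
  have h1 := (Complex.exp_sub_sum_range_isBigO_pow 5).comp_tendsto h
  have h2 : ((fun x : ℂ => x ^ 5) ∘ fun s => s * y) =O[𝓝[≠] (0 : ℂ)] fun s => s ^ 5 := by
    have := (Asymptotics.isBigO_refl (fun s : ℂ => s ^ 5) (𝓝[≠] 0)).const_mul_left (y ^ 5)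
    exact this.congr_left fun s => by simp [mul_pow, mul_comm]
  refine (h1.trans h2).congr_left fun s => ?_
  simp only [Function.comp, expCoeff]
  congr 1
  exact Finset.sum_congr rfl fun j _ => by rw [mul_pow]; ring

/-- The factor `s * ℓ / (1 - exp (-s * ℓ))` of the integrand, regular at the origin. -/
noncomputable def toddFactor (ℓ : ℝ) (s : ℂ) : ℂ := s * ℓ / (1 - Complex.exp (-(s * ℓ)))

/-- The Taylor coefficients of `toddFactor ℓ`. -/
noncomputable def toddCoeff (ℓ : ℂ) : ℕ → ℂ
  | 0 => 1
  | 1 => ℓ / 2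
  | 2 => ℓ ^ 2 / 12
  | 4 => -ℓ ^ 4 / 720
  | _ => 0

/-- The expansion is checked by multiplication: `s * ℓ` minus `φ s` times the claimed polynomial is
`O(s ^ 6)`, and division by `φ s ~ ℓ * s` costs one order. The punctured neighbourhood matters,
because `toddFactor` takes the value `0` at the origin by the convention for division by zero. -/
lemma hasTaylor_toddFactor {ℓ : ℝ} (hℓ : 0 < ℓ) : HasTaylor (toddFactor ℓ) (toddCoeff ℓ) := by
  have hℓ0 : (ℓ : ℂ) ≠ 0 := by exact_mod_cast hℓ.ne'
  set φ : ℂ → ℂ := fun s => 1 - Complex.exp (-(s * ℓ)) with hφ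
  have hd : HasDerivAt φ ℓ 0 := by
    have h1 : HasDerivAt (fun s : ℂ => -(s * ℓ)) (-(1 * ℓ)) 0 :=
      ((hasDerivAt_id (0 : ℂ)).mul_const _).neg
    simpa using h1.cexp.const_sub 1
  have hslope : Tendsto (fun s => φ s / s) (𝓝[≠] 0) (𝓝 ℓ) := by
    have := hasDerivAt_iff_tendsto_slope.1 hd
    refine this.congr fun s => ?_
    simp [slope_def_field, hφ]
  have hbd : (fun s : ℂ => (φ s / s)⁻¹) =O[𝓝[≠] (0 : ℂ)] fun _ => (1 : ℂ) :=
    (hslope.inv₀ hℓ0).isBigO_one ℂ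
  have hne : ∀ᶠ s in 𝓝[≠] (0 : ℂ), φ s ≠ 0 := by
    filter_upwards [hslope.eventually_ne hℓ0] with s hs h0
    exact hs (by rw [h0, zero_div])
  have hexp6 : (fun s => φ s - ((s * ℓ) - (s * ℓ) ^ 2 / 2 + (s * ℓ) ^ 3 / 6 - (s * ℓ) ^ 4 / 24
      + (s * ℓ) ^ 5 / 120)) =O[𝓝[≠] (0 : ℂ)] fun s => s ^ 6 := by
    have h : Tendsto (fun s : ℂ => -(s * ℓ)) (𝓝[≠] 0) (𝓝 0) := by
      have : Continuous fun s : ℂ => -(s * ℓ) := by fun_prop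
      simpa using (this.tendsto 0).mono_left nhdsWithin_le_nhds
    have h1 := (Complex.exp_sub_sum_range_isBigO_pow 6).comp_tendsto h
    have h2 : ((fun x : ℂ => x ^ 6) ∘ fun s => -(s * ℓ)) =O[𝓝[≠] (0 : ℂ)] fun s => s ^ 6 := by
      have := (Asymptotics.isBigO_refl (fun s : ℂ => s ^ 6) (𝓝[≠] 0)).const_mul_left ((-ℓ) ^ 6)
      exact this.congr_left fun s => by simp only [Function.comp]; ring
    refine (h1.trans h2).neg_left.congr_left fun s => ?_
    simp only [hφ, Function.comp, Finset.sum_range_succ, Finset.sum_range_zero, Nat.factorial]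
    push_cast
    ring
  have hpoly := isBigO_one_of_continuous (g := fun s : ℂ => ∑ j ∈ Finset.range 5,
    toddCoeff ℓ j * s ^ j) (by fun_prop)
  -- This is `s * ℓ` minus the product of the Taylor polynomial of `φ` with the claimed one: the
  -- orders up to five cancel and the orders six to nine remain.
  have hrest := (isBigO_one_of_continuous (g := fun s : ℂ =>
    -(ℓ : ℂ) ^ 6 * (1 / 720 + (s * ℓ) / 2160 + (s * ℓ) ^ 2 / 17280 - (s * ℓ) ^ 3 / 86400))
    (by fun_prop)).mul (Asymptotics.isBigO_refl (fun s : ℂ => s ^ 6) (𝓝[≠] 0))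
  have hprod := hexp6.mul hpoly
  simp only [mul_one, one_mul] at hrest hprod
  have hnum := hrest.sub hprod
  have hdiv := (hnum.mul (Asymptotics.isBigO_refl (fun s : ℂ => s⁻¹) (𝓝[≠] 0))).mul hbd
  refine (hdiv.congr' ?_ ?_)
  · filter_upwards [self_mem_nhdsWithin, hne] with s hs h0
    have hs : s ≠ 0 := hs
    have e : toddFactor ℓ s = s * ℓ / φ s := rfl
    rw [e]
    simp only [Finset.sum_range_succ, Finset.sum_range_zero, toddCoeff]
    field_simp
    ring
  · filter_upwards [self_mem_nhdsWithin] with s hs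
    have hs : s ≠ 0 := hs
    field_simp

/-! ### Poles of the kernel and evaluation of the contour integral -/

/-- The residue of Perron's kernel at `2 * π * I * m / ℓ i`. -/
noncomputable def poleResidue {ι : Type*} [Fintype ι] [DecidableEq ι] (ℓ : ι → ℝ) (y : ℝ) (i : ι)
    (m : ℤ) : ℂ :=
  Complex.exp (2 * π * Complex.I * m / ℓ i * y) / (2 * π * Complex.I * m)
    * ∏ j ∈ Finset.univ.erase i, (1 - Complex.exp (-(2 * π * Complex.I * m / ℓ i * ℓ j)))⁻¹

lemma tendsto_sub_mul_inv_one_sub_exp {ℓ : ℝ} (hℓ : 0 < ℓ) {p : ℂ}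
    (hp : Complex.exp (-(p * ℓ)) = 1) :
    Tendsto (fun s => (s - p) * (1 - Complex.exp (-(s * ℓ)))⁻¹) (𝓝[≠] p) (𝓝 (ℓ : ℂ)⁻¹) := by
  have hℓ0 : (ℓ : ℂ) ≠ 0 := by exact_mod_cast hℓ.ne'
  have hd : HasDerivAt (fun s : ℂ => 1 - Complex.exp (-(s * ℓ))) ℓ p := by
    have h1 : HasDerivAt (fun s : ℂ => -(s * ℓ)) (-(1 * ℓ)) p :=
      ((hasDerivAt_id p).mul_const _).neg
    simpa [hp] using h1.cexp.const_sub 1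
  refine ((hasDerivAt_iff_tendsto_slope.1 hd).inv₀ hℓ0).congr fun s => ?_
  rw [slope_def_field, hp, sub_self, sub_zero, inv_div, div_eq_mul_inv]

lemma exists_int_of_one_sub_exp_eq_zero {ℓ : ℝ} (hℓ : 0 < ℓ) {s : ℂ}
    (h : 1 - Complex.exp (-(s * ℓ)) = 0) : ∃ m : ℤ, s = 2 * π * Complex.I * m / ℓ := by
  have hℓ0 : (ℓ : ℂ) ≠ 0 := by exact_mod_cast hℓ.ne'
  obtain ⟨m, hm⟩ := Complex.exp_eq_one_iff.1 (sub_eq_zero.1 h).symm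
  refine ⟨-m, ?_⟩
  rw [eq_div_iff hℓ0]
  push_cast
  linear_combination -hm

/-- Incommensurable periods have no common nonzero pole, so all poles except the origin are simple.
-/
lemma one_sub_exp_ne_zero_of_ne {ι : Type*} {ℓ : ι → ℝ} (hpos : ∀ i, 0 < ℓ i)
    (hirr : ∀ i j, i ≠ j → ∀ k m : ℤ, k ≠ 0 → k * ℓ i ≠ m * ℓ j) {i j : ι} (hij : j ≠ i) {m : ℤ}
    (hm : m ≠ 0) : 1 - Complex.exp (-(2 * π * Complex.I * m / ℓ i * ℓ j)) ≠ 0 := fun h => by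
  obtain ⟨k, hk⟩ := exists_int_of_one_sub_exp_eq_zero (hpos j) h
  have hi : (ℓ i : ℂ) ≠ 0 := by exact_mod_cast (hpos i).ne'
  have hj : (ℓ j : ℂ) ≠ 0 := by exact_mod_cast (hpos j).ne'
  refine hirr j i hij m k hm ?_
  have h2 := Complex.two_pi_I_ne_zero
  rw [div_eq_div_iff hi hj] at hk
  have : (2 * π * Complex.I) * (m * ℓ j : ℂ) = (2 * π * Complex.I) * (k * ℓ i : ℂ) := by
    linear_combination hk
  exact_mod_cast mul_left_cancel₀ h2 this

/-- Evaluation of the contour integral by residues. -/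
theorem rectIntegral_eq_residues {ι : Type*} [Fintype ι] [DecidableEq ι] {ℓ : ι → ℝ}
    (hpos : ∀ i, 0 < ℓ i)
    (hirr : ∀ i j, i ≠ j → ∀ k m : ℤ, k ≠ 0 → k * ℓ i ≠ m * ℓ j) (hcard : Fintype.card ι ≤ 4)
    {y : ℝ} {a : ℕ → ℂ}
    (ha : HasTaylor (fun s => Complex.exp (s * y) * ∏ i, toddFactor (ℓ i) s) a) {R : ℝ}
    (hR : 1 ≤ R) (hRℓ : ∀ i, ∀ k : ℕ, R * ℓ i ≠ k) :
    rectIntegral (√R) (2 * π * R)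
        (fun s => Complex.exp (s * y) / s * ∏ i, (1 - Complex.exp (-(s * ℓ i)))⁻¹)
      = 2 * π * Complex.I * (a (Fintype.card ι) / ∏ i, (ℓ i : ℂ)
        + ∑ i, ∑ k ∈ Finset.Icc 1 ⌊R * ℓ i⌋₊, (poleResidue ℓ y i k + poleResidue ℓ y i (-k))) := by
  have hRpos : 0 < R := one_pos.trans_le hR
  have hW : 0 < √R := Real.sqrt_pos.2 hRpos
  have hT : 0 < 2 * π * R := by positivity
  have hℓ0 : ∀ i, (ℓ i : ℂ) ≠ 0 := fun i => by exact_mod_cast (hpos i).ne'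
  have hprod0 : (∏ i, (ℓ i : ℂ)) ≠ 0 := Finset.prod_ne_zero_iff.2 fun i _ => hℓ0 i
  have h2πI := Complex.two_pi_I_ne_zero
  set n := Fintype.card ι with hn
  set f : ℂ → ℂ := fun s => Complex.exp (s * y) / s * ∏ i, (1 - Complex.exp (-(s * ℓ i)))⁻¹
    with hf
  -- The principal part at the origin without its `1 / s` term. Its exponents are at most `-2`, so
  -- it has a primitive and integrates to zero; subtracting it makes the pole at the origin simple.
  set h : ℂ → ℂ := fun s => ∑ j ∈ Finset.range n, a j / (∏ i, (ℓ i : ℂ)) * s ^ ((j : ℤ) - n - 1)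
    with hh
  have hhc : ∀ s, s ≠ 0 → DifferentiableAt ℂ h s := fun s hs => by
    refine DifferentiableAt.fun_sum fun j _ => ?_
    exact (differentiableAt_zpow.2 (Or.inl hs)).const_mul _
  have hbne : ∀ s ∈ rectBoundary (√R) (2 * π * R), s ≠ 0 := fun s hs =>
    ne_of_mem_rectBoundary (by simpa using hW) (by simpa using hT) hs
  have hhint : rectIntegral (√R) (2 * π * R) h = 0 := by
    refine rectIntegral_eq_zero_of_hasDerivAt hW hT
      (F := fun s => ∑ j ∈ Finset.range n,
        a j / (∏ i, (ℓ i : ℂ)) / ((j : ℤ) - n : ℤ) * s ^ ((j : ℤ) - n))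
      (fun s hs => (hhc s (hbne s hs)).continuousAt.continuousWithinAt) fun s hs => ?_
    refine HasDerivAt.fun_sum fun j hj => ?_
    have h1 := (hasDerivAt_zpow ((j : ℤ) - n) s (Or.inl (hbne s hs))).const_mul
      (a j / (∏ i, (ℓ i : ℂ)) / ((j : ℤ) - n : ℤ))
    have h2 : (((j : ℤ) - n : ℤ) : ℂ) ≠ 0 := by
      have := Finset.mem_range.1 hj
      exact_mod_cast (by omega : (j : ℤ) - n ≠ 0)
    rwa [← mul_assoc, div_mul_cancel₀ _ h2] at h1
  -- Labels of the poles inside the contour: `none` is the origin and `(i, k, ε)` is `2πiεk / ℓ i`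
  -- with a sign `ε`.
  set A : Finset (Option (Σ _ : ι, ℕ × ℤ)) := Finset.insertNone
    (Finset.univ.sigma fun i => Finset.Icc 1 ⌊R * ℓ i⌋₊ ×ˢ ({1, -1} : Finset ℤ)) with hA
  set p : Option (Σ _ : ι, ℕ × ℤ) → ℂ := fun q => q.elim 0 fun q =>
    2 * π * Complex.I * ((q.2.2 * q.2.1 : ℤ) : ℂ) / ℓ q.1 with hp
  set r : Option (Σ _ : ι, ℕ × ℤ) → ℂ := fun q => q.elim (a n / ∏ i, (ℓ i : ℂ)) fun q =>
    poleResidue ℓ y q.1 (q.2.2 * q.2.1) with hr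
  have hmem : ∀ i k ε, some (⟨i, k, ε⟩ : Σ _ : ι, ℕ × ℤ) ∈ A ↔
      (1 ≤ k ∧ k ≤ ⌊R * ℓ i⌋₊) ∧ (ε = 1 ∨ ε = -1) := fun i k ε => by
    simp [hA]
  have hin : ∀ q ∈ A, |(p q).re| < √R ∧ |(p q).im| < 2 * π * R := by
    rintro (_ | ⟨i, k, ε⟩) hq
    · exact ⟨by simpa [hp] using hW, by simpa [hp] using hT⟩
    · rw [hmem] at hq
      have e : p (some ⟨i, k, ε⟩) = ((2 * π * (ε * k) / ℓ i : ℝ) : ℂ) * Complex.I := by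
        simp only [hp, Option.elim]
        push_cast
        ring
      -- Strict, because `R * ℓ i` is not an integer: no pole lies on a horizontal side.
      have hk : (k : ℝ) < R * ℓ i :=
        lt_of_le_of_ne ((Nat.le_floor_iff (by have := hpos i; positivity)).1 hq.1.2)
          (hRℓ i k).symm
      have hε : |(ε : ℝ)| = 1 := by rcases hq.2 with h | h <;> simp [h]
      rw [e]
      refine ⟨by simpa using hRpos, ?_⟩
      rw [Complex.im_ofReal_mul, Complex.I_im, mul_one, abs_div, abs_mul, abs_mul (ε : ℝ), hε,
        abs_of_pos (hpos i), abs_of_pos (by positivity : 0 < 2 * π), one_mul, Nat.abs_cast,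
        div_lt_iff₀ (hpos i)]
      nlinarith [pi_pos]
  have hnz : ∀ i k ε, some (⟨i, k, ε⟩ : Σ _ : ι, ℕ × ℤ) ∈ A → (ε * k : ℤ) ≠ 0 := by
    intro i k ε hq
    rw [hmem] at hq
    rcases hq.2 with h | h <;> subst h <;> omega
  have hinj : Set.InjOn p A := by
    rintro (_ | ⟨i, k, ε⟩) hq (_ | ⟨i', k', ε'⟩) hq' he
    · rfl
    · have := hnz _ _ _ hq'
      simp only [hp, Option.elim] at he
      rw [eq_comm, div_eq_zero_iff, or_iff_left (hℓ0 _), mul_eq_zero, or_iff_right h2πI] at he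
      exact absurd (by exact_mod_cast he) this
    · have := hnz _ _ _ hq
      simp only [hp, Option.elim] at he
      rw [div_eq_zero_iff, or_iff_left (hℓ0 _), mul_eq_zero, or_iff_right h2πI] at he
      exact absurd (by exact_mod_cast he) this
    · have h1 := hnz _ _ _ hq
      simp only [hp, Option.elim] at he
      rw [div_eq_div_iff (hℓ0 _) (hℓ0 _), mul_assoc (2 * π * Complex.I : ℂ), mul_assoc (2 * π * Complex.I : ℂ)] at he
      have he' : ((ε * k : ℤ) : ℝ) * ℓ i' = ((ε' * k' : ℤ) : ℝ) * ℓ i := by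
        exact_mod_cast mul_left_cancel₀ h2πI he
      by_cases hi : i' = i
      · subst hi
        have h3 : (ε * k : ℤ) = ε' * k' := by
          exact_mod_cast mul_right_cancel₀ (hpos i').ne' he'
        have g1 := (hmem _ _ _).1 hq
        have g2 := (hmem _ _ _).1 hq'
        obtain ⟨rfl, rfl⟩ : k = k' ∧ ε = ε' := by
          rcases g1.2 with h | h <;> rcases g2.2 with h' | h' <;> subst h <;> subst h' <;> omega
        rfl
      · exact absurd he' (hirr i' i hi _ _ h1)
  have hfd : ∀ s, s ≠ 0 → (∀ i, 1 - Complex.exp (-(s * ℓ i)) ≠ 0) → DifferentiableAt ℂ f s := by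
    intro s hs hs'
    refine DifferentiableAt.mul (by fun_prop (disch := assumption)) ?_
    refine DifferentiableAt.fun_finsetProd fun i _ => ?_
    have := hs' i
    fun_prop (disch := assumption)
  have hne : ∀ s : ℂ, |s.im| ≤ 2 * π * R → (∀ q ∈ A, s ≠ p q) →
      s ≠ 0 ∧ ∀ i, 1 - Complex.exp (-(s * ℓ i)) ≠ 0 := by
    intro s hs hq
    have hs0 : s ≠ 0 := hq none (by simp [hA])
    refine ⟨hs0, fun i hi => ?_⟩
    obtain ⟨m, rfl⟩ := exists_int_of_one_sub_exp_eq_zero (hpos i) hi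
    have hm : m ≠ 0 := by rintro rfl; simp at hs0
    refine hq (some ⟨i, m.natAbs, m.sign⟩) ((hmem _ _ _).2 ⟨⟨by omega, ?_⟩, ?_⟩) ?_
    · rw [Nat.le_floor_iff (by have := hpos i; positivity)]
      have e : (2 * π * Complex.I * m / ℓ i : ℂ) = ((2 * π * m / ℓ i : ℝ) : ℂ) * Complex.I := by
        push_cast; ring
      rw [e, Complex.im_ofReal_mul, Complex.I_im, mul_one, abs_div, abs_mul,
        abs_of_pos (hpos i), abs_of_pos (by positivity : 0 < 2 * π), div_le_iff₀ (hpos i)] at hs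
      rw [Nat.cast_natAbs, Int.cast_abs]
      have : 0 < 2 * π := by positivity
      nlinarith
    · rcases hm.lt_or_gt with h | h
      · exact Or.inr (Int.sign_eq_neg_one_of_neg h)
      · exact Or.inl (Int.sign_eq_one_of_pos h)
    · simp only [hp, Option.elim, Int.sign_mul_natAbs]
  have hres : ∀ q ∈ A, Tendsto (fun s => (s - p q) * (f s - h s)) (𝓝[≠] (p q)) (𝓝 (r q)) := by
    rintro (_ | ⟨i, k, ε⟩) hq
    · have h1 := (ha.tendsto_coeff hcard).div_const (∏ i, (ℓ i : ℂ))
      refine h1.congr' ?_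
      filter_upwards [self_mem_nhdsWithin] with s hs
      have hs : s ≠ 0 := hs
      have e1 : ∏ i, toddFactor (ℓ i) s
          = s ^ n * (∏ i, (ℓ i : ℂ)) * ∏ i, (1 - Complex.exp (-(s * ℓ i)))⁻¹ := by
        simp only [toddFactor, div_eq_mul_inv, Finset.prod_mul_distrib, Finset.prod_const,
          Finset.card_univ, hn]
      have e2 : ∀ j ∈ Finset.range n, s ^ ((j : ℤ) - n - 1) = s ^ j / s ^ n / s := fun j _ => by
        rw [zpow_sub₀ hs, zpow_sub₀ hs, zpow_natCast, zpow_natCast, zpow_one]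
      have e3 : h s = (∑ j ∈ Finset.range n, a j * s ^ j) / s ^ n / s / ∏ i, (ℓ i : ℂ) := by
        simp only [hh, Finset.sum_div]
        refine Finset.sum_congr rfl fun j hj => ?_
        rw [e2 j hj]
        ring
      have e4 : p none = 0 := rfl
      have hsn : s ^ n ≠ 0 := pow_ne_zero _ hs
      simp only [e3, e4, hf, e1, sub_zero]
      generalize ∏ i, (1 - Complex.exp (-(s * ℓ i)))⁻¹ = G
      field_simp
    · have hm := hnz _ _ _ hq
      have e : p (some ⟨i, k, ε⟩) = 2 * π * Complex.I * ((ε * k : ℤ) : ℂ) / ℓ i := rfl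
      have er : r (some ⟨i, k, ε⟩) = poleResidue ℓ y i (ε * k) := rfl
      rw [e, er]
      generalize (ε * k : ℤ) = m at hm
      set P : ℂ := 2 * π * Complex.I * (m : ℂ) / ℓ i with hP
      have hm' : (m : ℂ) ≠ 0 := by exact_mod_cast hm
      have hP0 : P ≠ 0 := div_ne_zero (mul_ne_zero h2πI hm') (hℓ0 i)
      have hPexp : Complex.exp (-(P * ℓ i)) = 1 := by
        rw [Complex.exp_eq_one_iff]
        refine ⟨-m, ?_⟩
        rw [hP, div_mul_cancel₀ _ (hℓ0 i)]
        push_cast; ring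
      have h1 := tendsto_sub_mul_inv_one_sub_exp (hpos i) hPexp
      have h2 : ContinuousAt (fun s : ℂ => Complex.exp (s * y) / s
          * ∏ j ∈ Finset.univ.erase i, (1 - Complex.exp (-(s * ℓ j)))⁻¹) P := by
        refine ContinuousAt.mul (by fun_prop (disch := assumption)) ?_
        refine tendsto_finsetProd _ fun j hj => ?_
        have h3 := one_sub_exp_ne_zero_of_ne hpos hirr (Finset.ne_of_mem_erase hj) hm
        have h4 : ContinuousAt (fun s : ℂ => (1 - Complex.exp (-(s * ℓ j)))⁻¹) P := by
          fun_prop (disch := assumption)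
        exact h4
      have h5 : Tendsto (fun s => (s - P) * h s) (𝓝[≠] P) (𝓝 0) := by
        have : ContinuousAt (fun s => (s - P) * h s) P :=
          ContinuousAt.mul (by fun_prop) (hhc P hP0).continuousAt
        simpa using this.tendsto.mono_left nhdsWithin_le_nhds
      have h6 := (h1.mul (h2.tendsto.mono_left nhdsWithin_le_nhds)).sub h5
      convert h6 using 2 with s
      · simp only [hf]
        rw [← Finset.mul_prod_erase Finset.univ _ (Finset.mem_univ i)]
        ring
      · rw [poleResidue, sub_zero, ← hP]
        have : 2 * π * Complex.I * m = P * ℓ i := (div_mul_cancel₀ _ (hℓ0 i)).symm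
        rw [this]
        have := hℓ0 i
        field_simp
  have hkey := rectIntegral_eq_sum_residues A p r hW hT hinj hin (fun s => f s - h s)
    (fun s _ h2 h3 => by
      obtain ⟨g1, g2⟩ := hne s h2 h3
      exact (hfd s g1 g2).sub (hhc s g1)) hres
  have hbd : ∀ s ∈ rectBoundary (√R) (2 * π * R), s ≠ 0 ∧ DifferentiableAt ℂ f s := fun s hs => by
    obtain ⟨g1, g2⟩ := hne s (by rcases hs with h | h <;> linarith [h.1, h.2])
      (fun q hq => ne_of_mem_rectBoundary (hin q hq).1 (hin q hq).2 hs)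
    exact ⟨g1, hfd s g1 g2⟩
  rw [rectIntegral_sub hW hT (fun s hs => (hbd s hs).2.continuousAt.continuousWithinAt)
    (fun s hs => (hhc s (hbd s hs).1).continuousAt.continuousWithinAt), hhint, sub_zero] at hkey
  rw [hkey]
  congr 1
  simp only [hA, hr, Finset.sum_insertNone, Option.elim, Finset.sum_sigma, Finset.sum_product]
  congr 1
  refine Finset.sum_congr rfl fun i _ => Finset.sum_congr rfl fun k _ => ?_
  rw [Finset.sum_pair (by norm_num)]
  simp

/-! ### Trigonometric form of the residues -/

/-- The partial sums of the sawtooth series of period `u`. -/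
noncomputable def sinSum (u y R : ℝ) : ℝ :=
  ∑ k ∈ Finset.Icc 1 ⌊R * u⌋₊, sin (2 * π * k * (y / u)) / k

/-- The cotangent of `π * k * v / u`. -/
noncomputable def cotRatio (u v : ℝ) (k : ℕ) : ℝ := cos (π * k * v / u) / sin (π * k * v / u)

/-- The partial sums of the cosine series with one cotangent. -/
noncomputable def cosCotSum (u v y R : ℝ) : ℝ :=
  ∑ k ∈ Finset.Icc 1 ⌊R * u⌋₊, cos (2 * π * k * (y / u)) * cotRatio u v k / k

/-- The partial sums of the sine series with two cotangents. -/
noncomputable def sinCotCotSum (u v w y R : ℝ) : ℝ :=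
  ∑ k ∈ Finset.Icc 1 ⌊R * u⌋₊, sin (2 * π * k * (y / u)) * cotRatio u v k * cotRatio u w k / k

/-- The partial sums of the cosine series with three cotangents. -/
noncomputable def cosCotCotCotSum (u v w z y R : ℝ) : ℝ :=
  ∑ k ∈ Finset.Icc 1 ⌊R * u⌋₊,
    cos (2 * π * k * (y / u)) * cotRatio u v k * cotRatio u w k * cotRatio u z k / k

/-- No nonzero integral multiple of an entry of `ℓ` is an integral multiple of another entry. -/
def Incommensurable {ι : Type*} (ℓ : ι → ℝ) : Prop :=
  ∀ i j, i ≠ j → ∀ k m : ℤ, k ≠ 0 → k * ℓ i ≠ m * ℓ j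

lemma Incommensurable.comp {ι κ : Type*} {ℓ : ι → ℝ} (h : Incommensurable ℓ) {σ : κ → ι}
    (hσ : Function.Injective σ) : Incommensurable (ℓ ∘ σ) :=
  fun i j hij => h (σ i) (σ j) (hσ.ne hij)

lemma Incommensurable.sin_ne_zero {ι : Type*} {ℓ : ι → ℝ} (h : Incommensurable ℓ)
    (hpos : ∀ i, 0 < ℓ i) {i j : ι} (hij : j ≠ i) {k : ℕ} (hk : k ≠ 0) :
    sin (π * k * ℓ j / ℓ i) ≠ 0 := fun h0 => by
  obtain ⟨m, hm⟩ := Real.sin_eq_zero_iff.1 h0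
  refine h j i hij k m (by exact_mod_cast hk) ?_
  rw [eq_div_iff (hpos i).ne'] at hm
  refine mul_left_cancel₀ pi_ne_zero ?_
  push_cast
  linear_combination -hm

/-- This is `1 - exp (-2it) = 2i sin t exp (-it)`, inverted. -/
lemma inv_one_sub_exp_eq {t : ℝ} (ht : sin t ≠ 0) :
    (1 - Complex.exp (-(2 * t * Complex.I)))⁻¹ = (1 - Complex.I * (cos t / sin t : ℝ)) / 2 := by
  have e : Complex.exp (-(2 * t * Complex.I)) = (cos t - sin t * Complex.I : ℂ) ^ 2 := by
    have h1 : (cos t - sin t * Complex.I : ℂ) = Complex.exp ((-t : ℝ) * Complex.I) := by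
      rw [Complex.exp_mul_I, ← Complex.ofReal_cos, ← Complex.ofReal_sin, Real.cos_neg,
        Real.sin_neg]
      push_cast
      ring
    rw [h1, ← Complex.exp_nat_mul]
    congr 1
    push_cast
    ring
  have hs : (sin t : ℂ) ≠ 0 := by exact_mod_cast ht
  have hsc : (sin t : ℂ) ^ 2 + (cos t : ℂ) ^ 2 = 1 := by exact_mod_cast sin_sq_add_cos_sq t
  rw [e]
  apply inv_eq_of_mul_eq_one_right
  rw [Complex.ofReal_div]
  generalize (sin t : ℂ) = S at *
  generalize (cos t : ℂ) = C at *
  field_simp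
  have hI := Complex.I_sq
  linear_combination (-2 * C ^ 2 * S - S ^ 2 * (S - Complex.I * C)) * hI
    + (S + Complex.I * C) * hsc

/-- The numerators of the residues at the indices `k` and `-k` are complex conjugates and the
denominators `±2πik` have opposite signs, so the sum has the form `(z - conj z) / (2πik)` and is
real. -/
lemma poleResidue_add_neg {ι : Type*} [Fintype ι] [DecidableEq ι] {ℓ : ι → ℝ}
    (h : Incommensurable ℓ) (hpos : ∀ i, 0 < ℓ i) (y : ℝ) (i : ι) {k : ℕ} (hk : k ≠ 0) :
    poleResidue ℓ y i k + poleResidue ℓ y i (-k) =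
      ((cos (2 * π * k * (y / ℓ i)) + Complex.I * sin (2 * π * k * (y / ℓ i)))
          * ∏ j ∈ Finset.univ.erase i, (1 - Complex.I * cotRatio (ℓ i) (ℓ j) k) / 2
        - (cos (2 * π * k * (y / ℓ i)) - Complex.I * sin (2 * π * k * (y / ℓ i)))
          * ∏ j ∈ Finset.univ.erase i, (1 + Complex.I * cotRatio (ℓ i) (ℓ j) k) / 2)
        / (2 * π * Complex.I * k) := by
  have hi : (ℓ i : ℂ) ≠ 0 := by exact_mod_cast (hpos i).ne'
  have e1 : ∀ j ∈ Finset.univ.erase i,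
      (1 - Complex.exp (-(2 * π * Complex.I * (k : ℤ) / ℓ i * ℓ j)))⁻¹
        = (1 - Complex.I * cotRatio (ℓ i) (ℓ j) k) / 2 := fun j hj => by
    rw [cotRatio, ← inv_one_sub_exp_eq (h.sin_ne_zero hpos (Finset.ne_of_mem_erase hj) hk)]
    congr 4
    push_cast
    ring
  have e2 : ∀ j ∈ Finset.univ.erase i,
      (1 - Complex.exp (-(2 * π * Complex.I * (-k : ℤ) / ℓ i * ℓ j)))⁻¹
        = (1 + Complex.I * cotRatio (ℓ i) (ℓ j) k) / 2 := fun j hj => by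
    have h0 := h.sin_ne_zero hpos (Finset.ne_of_mem_erase hj) hk
    have h1 := inv_one_sub_exp_eq (t := -(π * k * ℓ j / ℓ i)) (by rwa [Real.sin_neg, neg_ne_zero])
    rw [Real.sin_neg, Real.cos_neg, div_neg] at h1
    simp only [Complex.ofReal_neg, mul_neg, sub_neg_eq_add] at h1
    rw [cotRatio, ← h1]
    congr 3
    push_cast
    ring
  have e3 : Complex.exp (2 * π * Complex.I * (k : ℤ) / ℓ i * y)
      = cos (2 * π * k * (y / ℓ i)) + Complex.I * sin (2 * π * k * (y / ℓ i)) := by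
    rw [mul_comm Complex.I, Complex.ofReal_cos, Complex.ofReal_sin, ← Complex.exp_mul_I]
    congr 1
    push_cast
    ring
  have e4 : Complex.exp (2 * π * Complex.I * (-k : ℤ) / ℓ i * y)
      = cos (2 * π * k * (y / ℓ i)) - Complex.I * sin (2 * π * k * (y / ℓ i)) := by
    have : (cos (2 * π * k * (y / ℓ i)) - Complex.I * sin (2 * π * k * (y / ℓ i)) : ℂ)
      = cos (-(2 * π * k * (y / ℓ i))) + sin (-(2 * π * k * (y / ℓ i))) * Complex.I := by
      rw [Real.sin_neg, Real.cos_neg]; push_cast; ring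
    rw [this, Complex.ofReal_cos, Complex.ofReal_sin, ← Complex.exp_mul_I]
    congr 1
    push_cast
    ring
  rw [poleResidue, poleResidue, Finset.prod_congr rfl e1, Finset.prod_congr rfl e2, e3, e4]
  have hk' : (k : ℂ) ≠ 0 := by exact_mod_cast hk
  have := Complex.two_pi_I_ne_zero
  push_cast
  generalize ∏ j ∈ Finset.univ.erase i, (1 - Complex.I * cotRatio (ℓ i) (ℓ j) k : ℂ) / 2 = X
  generalize ∏ j ∈ Finset.univ.erase i, (1 + Complex.I * cotRatio (ℓ i) (ℓ j) k : ℂ) / 2 = Y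
  rw [mul_neg, div_neg, neg_mul, ← sub_eq_add_neg]
  ring

/-! ### Convergence of the residue sums -/

lemma hasTaylor_exp_mul_prod {ι : Type*} [Fintype ι] {ℓ : ι → ℝ} (hpos : ∀ i, 0 < ℓ i) (y : ℝ) :
    ∃ a, HasTaylor (fun s => Complex.exp (s * y) * ∏ i, toddFactor (ℓ i) s) a := by
  obtain ⟨b, hb⟩ := HasTaylor.exists_prod Finset.univ (g := fun i => toddFactor (ℓ i))
    fun i _ => ⟨_, hasTaylor_toddFactor (hpos i)⟩
  exact ⟨_, (hasTaylor_exp y).mul hb⟩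

lemma AvoidsIntegers.eventually_ne {l : Filter ℝ} {ℓ : ℝ} (h : AvoidsIntegers l ℓ) :
    ∀ᶠ R in l, ∀ k : ℕ, R * ℓ ≠ k := by
  obtain ⟨κ, h0, h1⟩ := h
  filter_upwards [h1] with R hR k hk
  have : 2 * π * R * ℓ = k * (2 * π) := by linear_combination 2 * π * hk
  rw [this, Real.cos_nat_mul_two_pi] at hR
  linarith

/-- The residue sums converge. -/
lemma tendsto_residueSum {l : Filter ℝ} (hl : l ≤ atTop) {n : ℕ} (hn : n ≠ 0) (hn4 : n ≤ 4)
    {ℓ : Fin n → ℝ} (hpos : ∀ i, 0 < ℓ i) (h : Incommensurable ℓ)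
    (hI : ∀ i, AvoidsIntegers l (ℓ i)) {y : ℝ} (hy : 0 ≤ y) {a : ℕ → ℂ}
    (ha : HasTaylor (fun s => Complex.exp (s * y) * ∏ i, toddFactor (ℓ i) s) a) :
    Tendsto (fun R => ∑ i, ∑ k ∈ Finset.Icc 1 ⌊R * ℓ i⌋₊,
      (poleResidue ℓ y i k + poleResidue ℓ y i (-k))) l
      (𝓝 (latticeCount (List.ofFn ℓ) y - a n / ∏ i, (ℓ i : ℂ))) := by
  have hne : List.ofFn ℓ ≠ [] := by simpa [List.ofFn_eq_nil_iff] using hn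
  have hpos' : ∀ u ∈ List.ofFn ℓ, 0 < u := by simpa [List.forall_mem_ofFn_iff] using hpos
  have hI' : ∀ u ∈ List.ofFn ℓ, AvoidsIntegers l u := by
    simpa [List.forall_mem_ofFn_iff] using hI
  have h1 := tendsto_perronIntegral hl hne hpos' hI' (y := y)
    (by linarith [List.sum_pos _ hpos' hne])
  refine (h1.sub_const (a n / ∏ i, (ℓ i : ℂ))).congr' ?_
  have h2 : ∀ᶠ R in l, ∀ i, ∀ k : ℕ, R * ℓ i ≠ k :=
    eventually_all.2 fun i => (hI i).eventually_ne
  filter_upwards [h2, hl (eventually_ge_atTop 1)] with R g1 g2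
  have e : perronKernel (List.ofFn ℓ) y
      = fun s => Complex.exp (s * y) / s * ∏ i, (1 - Complex.exp (-(s * ℓ i)))⁻¹ := by
    ext s
    rw [perronKernel, geomProd, List.map_ofFn, List.prod_ofFn]
    rfl
  rw [perronIntegral, e, rectIntegral_eq_residues hpos h (by simpa using hn4) ha g2 g1,
    inv_mul_cancel_left₀ Complex.two_pi_I_ne_zero, Fintype.card_fin, add_sub_cancel_left]

lemma tendsto_re_residueSum {l : Filter ℝ} {y : ℝ} (hl : l ≤ atTop) {n : ℕ} (hn : n ≠ 0) (hn4 : n ≤ 4)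
    {ℓ : Fin n → ℝ} (hpos : ∀ i, 0 < ℓ i) (h : Incommensurable ℓ)
    (hI : ∀ i, AvoidsIntegers l (ℓ i)) (hy : 0 ≤ y) {a : ℕ → ℂ}
    (ha : HasTaylor (fun s => Complex.exp (s * y) * ∏ i, toddFactor (ℓ i) s) a)
    {f : Fin n → ℕ → ℝ} (hf : ∀ i, ∀ k : ℕ, k ≠ 0 →
      poleResidue ℓ y i k + poleResidue ℓ y i (-k) = (f i k : ℂ)) :
    Tendsto (fun R => ∑ i, ∑ k ∈ Finset.Icc 1 ⌊R * ℓ i⌋₊, f i k) l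
      (𝓝 (latticeCount (List.ofFn ℓ) y - (a n / ∏ i, (ℓ i : ℂ)).re)) := by
  have h1 := (Complex.continuous_re.tendsto _).comp
    (tendsto_residueSum hl hn hn4 hpos h hI hy ha)
  rw [Complex.sub_re, Complex.ofReal_re] at h1
  refine h1.congr fun R => ?_
  simp only [Function.comp]
  rw [← Complex.ofReal_re (∑ i, ∑ k ∈ Finset.Icc 1 ⌊R * ℓ i⌋₊, f i k)]
  congr 1
  push_cast
  refine Finset.sum_congr rfl fun i _ => Finset.sum_congr rfl fun k hk => ?_
  exact hf i k (by have := (Finset.mem_Icc.1 hk).1; omega)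

/-! ### Pairs of conjugate residues in real form -/

/-- The pair of conjugate residues of a kernel with one period. -/
noncomputable def pairTermOne (u y : ℝ) (k : ℕ) : ℝ :=
  1 / π * (sin (2 * π * k * (y / u)) / k)

/-- The pair of conjugate residues of a kernel with two periods. -/
noncomputable def pairTermTwo (u v y : ℝ) (k : ℕ) : ℝ :=
  1 / (2 * π) * (sin (2 * π * k * (y / u)) / k - cos (2 * π * k * (y / u)) * cotRatio u v k / k)

/-- The pair of conjugate residues of a kernel with three periods. -/
noncomputable def pairTermThree (u v w y : ℝ) (k : ℕ) : ℝ :=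
  1 / (4 * π) * (sin (2 * π * k * (y / u)) / k
    - sin (2 * π * k * (y / u)) * cotRatio u v k * cotRatio u w k / k
    - cos (2 * π * k * (y / u)) * cotRatio u v k / k
    - cos (2 * π * k * (y / u)) * cotRatio u w k / k)

/-- The pair of conjugate residues of a kernel with four periods. -/
noncomputable def pairTermFour (u v w z y : ℝ) (k : ℕ) : ℝ :=
  1 / (8 * π) * (sin (2 * π * k * (y / u)) / k
    - sin (2 * π * k * (y / u)) * cotRatio u v k * cotRatio u w k / k
    - sin (2 * π * k * (y / u)) * cotRatio u v k * cotRatio u z k / k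
    - sin (2 * π * k * (y / u)) * cotRatio u w k * cotRatio u z k / k
    - cos (2 * π * k * (y / u)) * cotRatio u v k / k
    - cos (2 * π * k * (y / u)) * cotRatio u w k / k
    - cos (2 * π * k * (y / u)) * cotRatio u z k / k
    + cos (2 * π * k * (y / u)) * cotRatio u v k * cotRatio u w k * cotRatio u z k / k)

section

variable {ι : Type*} [Fintype ι] [DecidableEq ι] {ℓ : ι → ℝ} {y : ℝ} {i j m n : ι} {k : ℕ}

/-- This and the next three lemmas expand `im (exp (iθ) * ∏ (1 - i * cot) / 2) / (πk)`: an even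
number of cotangents goes with the sine and an odd number with the cosine. -/
lemma poleResidue_pair_one (h : Incommensurable ℓ) (hpos : ∀ i, 0 < ℓ i)
    (hi : Finset.univ.erase i = ∅) (hk : k ≠ 0) :
    poleResidue ℓ y i k + poleResidue ℓ y i (-k) = (pairTermOne (ℓ i) y k : ℂ) := by
  rw [poleResidue_add_neg h hpos y i hk, hi, Finset.prod_empty, Finset.prod_empty, pairTermOne]
  have hk' : (k : ℂ) ≠ 0 := by exact_mod_cast hk
  have hπ : (π : ℂ) ≠ 0 := by exact_mod_cast pi_ne_zero
  have hI := Complex.I_ne_zero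
  rw [div_eq_iff (by simp [hk', hπ, hI])]
  push_cast
  field_simp
  ring

lemma poleResidue_pair_two (h : Incommensurable ℓ) (hpos : ∀ i, 0 < ℓ i)
    (hi : Finset.univ.erase i = {j}) (hk : k ≠ 0) :
    poleResidue ℓ y i k + poleResidue ℓ y i (-k) = (pairTermTwo (ℓ i) (ℓ j) y k : ℂ) := by
  rw [poleResidue_add_neg h hpos y i hk, hi, Finset.prod_singleton, Finset.prod_singleton,
    pairTermTwo]
  have hk' : (k : ℂ) ≠ 0 := by exact_mod_cast hk
  have hπ : (π : ℂ) ≠ 0 := by exact_mod_cast pi_ne_zero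
  have hI := Complex.I_ne_zero
  rw [div_eq_iff (by simp [hk', hπ, hI])]
  push_cast
  generalize Complex.sin (2 * π * k * (y / ℓ i)) = S
  generalize Complex.cos (2 * π * k * (y / ℓ i)) = C
  generalize (cotRatio (ℓ i) (ℓ j) k : ℂ) = c
  field_simp
  ring

lemma poleResidue_pair_three (h : Incommensurable ℓ) (hpos : ∀ i, 0 < ℓ i) (hjm : j ≠ m)
    (hi : Finset.univ.erase i = {j, m}) (hk : k ≠ 0) :
    poleResidue ℓ y i k + poleResidue ℓ y i (-k)
      = (pairTermThree (ℓ i) (ℓ j) (ℓ m) y k : ℂ) := by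
  rw [poleResidue_add_neg h hpos y i hk, hi, Finset.prod_pair hjm, Finset.prod_pair hjm,
    pairTermThree]
  have hk' : (k : ℂ) ≠ 0 := by exact_mod_cast hk
  have hπ : (π : ℂ) ≠ 0 := by exact_mod_cast pi_ne_zero
  have hI := Complex.I_ne_zero
  have hI2 := Complex.I_sq
  rw [div_eq_iff (by simp [hk', hπ, hI])]
  push_cast
  generalize Complex.sin (2 * π * k * (y / ℓ i)) = S
  generalize Complex.cos (2 * π * k * (y / ℓ i)) = C
  generalize (cotRatio (ℓ i) (ℓ j) k : ℂ) = c
  generalize (cotRatio (ℓ i) (ℓ m) k : ℂ) = d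
  field_simp
  linear_combination (8 * Complex.I * S * c * d) * hI2

lemma poleResidue_pair_four (h : Incommensurable ℓ) (hpos : ∀ i, 0 < ℓ i) (hjm : j ≠ m)
    (hjn : j ≠ n) (hmn : m ≠ n) (hi : Finset.univ.erase i = {j, m, n}) (hk : k ≠ 0) :
    poleResidue ℓ y i k + poleResidue ℓ y i (-k)
      = (pairTermFour (ℓ i) (ℓ j) (ℓ m) (ℓ n) y k : ℂ) := by
  rw [poleResidue_add_neg h hpos y i hk, hi, Finset.prod_insert (by simp [hjm, hjn]),
    Finset.prod_pair hmn, Finset.prod_insert (by simp [hjm, hjn]), Finset.prod_pair hmn,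
    pairTermFour]
  have hk' : (k : ℂ) ≠ 0 := by exact_mod_cast hk
  have hπ : (π : ℂ) ≠ 0 := by exact_mod_cast pi_ne_zero
  have hI := Complex.I_ne_zero
  have hI2 := Complex.I_sq
  rw [div_eq_iff (by simp [hk', hπ, hI])]
  push_cast
  generalize Complex.sin (2 * π * k * (y / ℓ i)) = S
  generalize Complex.cos (2 * π * k * (y / ℓ i)) = C
  generalize (cotRatio (ℓ i) (ℓ j) k : ℂ) = c
  generalize (cotRatio (ℓ i) (ℓ m) k : ℂ) = d
  generalize (cotRatio (ℓ i) (ℓ n) k : ℂ) = e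
  field_simp
  linear_combination (16 * Complex.I * S * (c * d + c * e + d * e) - 16 * Complex.I * C * c * d * e) * hI2

end

lemma sum_pairTermTwo (u v y R : ℝ) : ∑ k ∈ Finset.Icc 1 ⌊R * u⌋₊, pairTermTwo u v y k
    = 1 / (2 * π) * (sinSum u y R - cosCotSum u v y R) := by
  simp only [pairTermTwo, sinSum, cosCotSum, ← Finset.mul_sum, Finset.sum_sub_distrib]

lemma sum_pairTermThree (u v w y R : ℝ) : ∑ k ∈ Finset.Icc 1 ⌊R * u⌋₊, pairTermThree u v w y k
    = 1 / (4 * π) * (sinSum u y R - sinCotCotSum u v w y R - cosCotSum u v y R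
      - cosCotSum u w y R) := by
  simp only [pairTermThree, sinSum, cosCotSum, sinCotCotSum, ← Finset.mul_sum,
    Finset.sum_sub_distrib]

lemma sum_pairTermFour (u v w z y R : ℝ) :
    ∑ k ∈ Finset.Icc 1 ⌊R * u⌋₊, pairTermFour u v w z y k
    = 1 / (8 * π) * (sinSum u y R - sinCotCotSum u v w y R - sinCotCotSum u v z y R
      - sinCotCotSum u w z y R - cosCotSum u v y R - cosCotSum u w y R - cosCotSum u z y R
      + cosCotCotCotSum u v w z y R) := by
  simp only [pairTermFour, sinSum, cosCotSum, sinCotCotSum, cosCotCotCotSum, ← Finset.mul_sum,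
    Finset.sum_sub_distrib, Finset.sum_add_distrib]

/-! ### Limits for one, two, three and four periods -/

/-- With one period the residues away from the origin are exactly the terms of the sawtooth series,
so Perron's formula yields its sum at every point, jumps included. -/
lemma tendsto_sinSum {l : Filter ℝ} {y : ℝ} (hl : l ≤ atTop) {u : ℝ} (hu : 0 < u)
    (hI : AvoidsIntegers l u) (hy : 0 ≤ y) :
    Tendsto (sinSum u y) l (𝓝 (π * (latticeCount [u] y - (y / u + 1 / 2)))) := by
  set ℓ : Fin 1 → ℝ := fun _ => u with hℓ
  have hpos : ∀ i, 0 < ℓ i := fun _ => hu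
  have hInc : Incommensurable ℓ := fun i j hij => absurd (Subsingleton.elim i j) hij
  have hu0 : (u : ℂ) ≠ 0 := by exact_mod_cast hu.ne'
  have ht := (hasTaylor_exp (y : ℂ)).mul (hasTaylor_toddFactor hu)
  have h1 := tendsto_re_residueSum hl one_ne_zero (by norm_num) hpos hInc (fun _ => hI) hy
    (a := cauchyProd (expCoeff y) (toddCoeff u)) (by simpa using ht)
    (f := fun _ => pairTermOne u y)
    (fun i k hk => by
      have hi : i = 0 := Subsingleton.elim _ _
      subst hi
      exact poleResidue_pair_one hInc hpos (by decide) hk)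
  have hA : cauchyProd (expCoeff y) (toddCoeff u) 1 / ∏ i, (ℓ i : ℂ)
      = ((y / u + 1 / 2 : ℝ) : ℂ) := by
    simp [hℓ, cauchyProd, expCoeff, toddCoeff, Finset.sum_range_succ]
    field_simp
    ring
  have e : List.ofFn ℓ = [u] := by simp [hℓ]
  rw [hA, Complex.ofReal_re, e] at h1
  refine (h1.const_mul π).congr fun R => ?_
  simp only [Fin.sum_univ_one, pairTermOne, sinSum, ← Finset.mul_sum, hℓ]
  rw [← mul_assoc, mul_one_div_cancel pi_ne_zero, one_mul]

/-- The limit is a lattice count minus a Taylor coefficient. It is chosen before the filter, which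
later makes the values of the series independent of `δ`; its explicit form is not needed. -/
lemma exists_tendsto_two {y : ℝ} {ℓ : Fin 2 → ℝ} (hpos : ∀ i, 0 < ℓ i) (h : Incommensurable ℓ)
    (hy : 0 ≤ y) : ∃ A : ℝ, ∀ l : Filter ℝ, l ≤ atTop → (∀ i, AvoidsIntegers l (ℓ i)) →
      Tendsto (fun R => sinSum (ℓ 0) y R + sinSum (ℓ 1) y R - cosCotSum (ℓ 0) (ℓ 1) y R
        - cosCotSum (ℓ 1) (ℓ 0) y R) l (𝓝 A) := by
  obtain ⟨a, ha⟩ := hasTaylor_exp_mul_prod hpos y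
  refine ⟨2 * π * (latticeCount (List.ofFn ℓ) y - (a 2 / ∏ i, (ℓ i : ℂ)).re),
    fun l hl hI => ?_⟩
  have h1 := tendsto_re_residueSum hl two_ne_zero (by norm_num) hpos h hI hy ha
    (f := ![pairTermTwo (ℓ 0) (ℓ 1) y, pairTermTwo (ℓ 1) (ℓ 0) y])
    (by
      intro i k hk
      fin_cases i
      · exact poleResidue_pair_two h hpos (by decide) hk
      · exact poleResidue_pair_two h hpos (by decide) hk)
  refine (h1.const_mul (2 * π)).congr fun R => ?_
  simp only [Fin.sum_univ_two, Matrix.cons_val_zero, Matrix.cons_val_one, sum_pairTermTwo]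
  field_simp
  ring

lemma exists_tendsto_three {y : ℝ} {ℓ : Fin 3 → ℝ} (hpos : ∀ i, 0 < ℓ i) (h : Incommensurable ℓ)
    (hy : 0 ≤ y) : ∃ A : ℝ, ∀ l : Filter ℝ, l ≤ atTop → (∀ i, AvoidsIntegers l (ℓ i)) →
      Tendsto (fun R => sinSum (ℓ 0) y R + sinSum (ℓ 1) y R + sinSum (ℓ 2) y R
        - (sinCotCotSum (ℓ 0) (ℓ 1) (ℓ 2) y R + sinCotCotSum (ℓ 1) (ℓ 0) (ℓ 2) y R
          + sinCotCotSum (ℓ 2) (ℓ 0) (ℓ 1) y R)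
        - (cosCotSum (ℓ 0) (ℓ 1) y R + cosCotSum (ℓ 1) (ℓ 0) y R)
        - (cosCotSum (ℓ 0) (ℓ 2) y R + cosCotSum (ℓ 2) (ℓ 0) y R)
        - (cosCotSum (ℓ 1) (ℓ 2) y R + cosCotSum (ℓ 2) (ℓ 1) y R)) l (𝓝 A) := by
  obtain ⟨a, ha⟩ := hasTaylor_exp_mul_prod hpos y
  refine ⟨4 * π * (latticeCount (List.ofFn ℓ) y - (a 3 / ∏ i, (ℓ i : ℂ)).re),
    fun l hl hI => ?_⟩
  have h1 := tendsto_re_residueSum hl three_ne_zero (by norm_num) hpos h hI hy ha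
    (f := ![pairTermThree (ℓ 0) (ℓ 1) (ℓ 2) y, pairTermThree (ℓ 1) (ℓ 0) (ℓ 2) y,
      pairTermThree (ℓ 2) (ℓ 0) (ℓ 1) y])
    (by
      intro i k hk
      fin_cases i
      · exact poleResidue_pair_three h hpos (by decide) (by decide) hk
      · exact poleResidue_pair_three h hpos (by decide) (by decide) hk
      · exact poleResidue_pair_three h hpos (by decide) (by decide) hk)
  refine (h1.const_mul (4 * π)).congr fun R => ?_
  simp only [Fin.sum_univ_three, Matrix.cons_val_zero, Matrix.cons_val_one, Matrix.cons_val,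
    sum_pairTermThree]
  field_simp
  ring

/-- The constant term for four periods `u`, `v`, `w`, `z`: the coefficient of `s ^ 4` in the
Taylor expansion of `exp (s * y)` times the four factors `toddFactor`. -/
noncomputable def quarticCoeff (u v w z y : ℂ) : ℂ :=
  cauchyProd (expCoeff y) (cauchyProd (cauchyProd (cauchyProd (toddCoeff u) (toddCoeff v))
    (toddCoeff w)) (toddCoeff z)) 4

/-- Among the cases of several periods, the only one whose limit is needed explicitly: it contains
both the count and the polynomial of the theorem. -/
lemma tendsto_four {y : ℝ} {ℓ : Fin 4 → ℝ} (hpos : ∀ i, 0 < ℓ i) (h : Incommensurable ℓ)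
    (hy : 0 ≤ y) {l : Filter ℝ} (hl : l ≤ atTop) (hI : ∀ i, AvoidsIntegers l (ℓ i)) :
    Tendsto (fun R => 1 / (8 * π) * (
        (sinSum (ℓ 0) y R + sinSum (ℓ 1) y R + sinSum (ℓ 2) y R + sinSum (ℓ 3) y R)
        - (sinCotCotSum (ℓ 0) (ℓ 1) (ℓ 2) y R + sinCotCotSum (ℓ 1) (ℓ 0) (ℓ 2) y R
          + sinCotCotSum (ℓ 2) (ℓ 0) (ℓ 1) y R)
        - (sinCotCotSum (ℓ 0) (ℓ 1) (ℓ 3) y R + sinCotCotSum (ℓ 1) (ℓ 0) (ℓ 3) y R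
          + sinCotCotSum (ℓ 3) (ℓ 0) (ℓ 1) y R)
        - (sinCotCotSum (ℓ 0) (ℓ 2) (ℓ 3) y R + sinCotCotSum (ℓ 2) (ℓ 0) (ℓ 3) y R
          + sinCotCotSum (ℓ 3) (ℓ 0) (ℓ 2) y R)
        - (sinCotCotSum (ℓ 1) (ℓ 2) (ℓ 3) y R + sinCotCotSum (ℓ 2) (ℓ 1) (ℓ 3) y R
          + sinCotCotSum (ℓ 3) (ℓ 1) (ℓ 2) y R)
        - (cosCotSum (ℓ 0) (ℓ 1) y R + cosCotSum (ℓ 1) (ℓ 0) y R)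
        - (cosCotSum (ℓ 0) (ℓ 2) y R + cosCotSum (ℓ 2) (ℓ 0) y R)
        - (cosCotSum (ℓ 0) (ℓ 3) y R + cosCotSum (ℓ 3) (ℓ 0) y R)
        - (cosCotSum (ℓ 1) (ℓ 2) y R + cosCotSum (ℓ 2) (ℓ 1) y R)
        - (cosCotSum (ℓ 1) (ℓ 3) y R + cosCotSum (ℓ 3) (ℓ 1) y R)
        - (cosCotSum (ℓ 2) (ℓ 3) y R + cosCotSum (ℓ 3) (ℓ 2) y R)
        + (cosCotCotCotSum (ℓ 0) (ℓ 1) (ℓ 2) (ℓ 3) y R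
          + cosCotCotCotSum (ℓ 1) (ℓ 0) (ℓ 2) (ℓ 3) y R
          + cosCotCotCotSum (ℓ 2) (ℓ 0) (ℓ 1) (ℓ 3) y R
          + cosCotCotCotSum (ℓ 3) (ℓ 0) (ℓ 1) (ℓ 2) y R))) l
      (𝓝 (latticeCount [ℓ 0, ℓ 1, ℓ 2, ℓ 3] y
        - (quarticCoeff (ℓ 0) (ℓ 1) (ℓ 2) (ℓ 3) y / (ℓ 0 * ℓ 1 * ℓ 2 * ℓ 3)).re)) := by
  have ht := (hasTaylor_exp (y : ℂ)).mul ((((hasTaylor_toddFactor (hpos 0)).mul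
    (hasTaylor_toddFactor (hpos 1))).mul (hasTaylor_toddFactor (hpos 2))).mul
    (hasTaylor_toddFactor (hpos 3)))
  have h1 := tendsto_re_residueSum hl four_ne_zero le_rfl hpos h hI hy
    (by simpa only [Fin.prod_univ_four] using ht)
    (f := ![pairTermFour (ℓ 0) (ℓ 1) (ℓ 2) (ℓ 3) y, pairTermFour (ℓ 1) (ℓ 0) (ℓ 2) (ℓ 3) y,
      pairTermFour (ℓ 2) (ℓ 0) (ℓ 1) (ℓ 3) y, pairTermFour (ℓ 3) (ℓ 0) (ℓ 1) (ℓ 2) y])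
    (by
      intro i k hk
      fin_cases i
      · exact poleResidue_pair_four h hpos (by decide) (by decide) (by decide) (by decide) hk
      · exact poleResidue_pair_four h hpos (by decide) (by decide) (by decide) (by decide) hk
      · exact poleResidue_pair_four h hpos (by decide) (by decide) (by decide) (by decide) hk
      · exact poleResidue_pair_four h hpos (by decide) (by decide) (by decide) (by decide) hk)
  have e : List.ofFn ℓ = [ℓ 0, ℓ 1, ℓ 2, ℓ 3] := by simp [List.ofFn_succ]
  rw [e, Fin.prod_univ_four] at h1
  refine h1.congr fun R => ?_
  simp only [Fin.sum_univ_four, Matrix.cons_val_zero, Matrix.cons_val_one, Matrix.cons_val,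
    sum_pairTermFour]
  ring

/-- The constant term for four periods is the polynomial `mainPoly`. -/
lemma quarticCoeff_div_eq_mainPoly {a b c d x : ℝ} (ha : log a ≠ 0) (hb : log b ≠ 0)
    (hc : log c ≠ 0) (hd : log d ≠ 0) :
    quarticCoeff (log a : ℝ) (log b : ℝ) (log c : ℝ) (log d : ℝ) (log x : ℝ)
      / ((log a : ℝ) * (log b : ℝ) * (log c : ℝ) * (log d : ℝ)) = (mainPoly a b c d x : ℂ) := by
  rw [mainPoly]
  generalize log a = u at *
  generalize log b = v at *
  generalize log c = w at *
  generalize log d = z at *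
  generalize log x = y at *
  have e : quarticCoeff u v w z y = ((y ^ 4 / 24
      + y ^ 3 * (u + v + w + z) / 12
      + y ^ 2 * ((u ^ 2 + v ^ 2 + w ^ 2 + z ^ 2) / 24
        + (u * v + u * w + u * z + v * w + v * z + w * z) / 8)
      + y * ((u * v * w + u * v * z + u * w * z + v * w * z) / 8
        + (u ^ 2 * (v + w + z) + v ^ 2 * (u + w + z) + w ^ 2 * (u + v + z)
          + z ^ 2 * (u + v + w)) / 24)
      + (u * v * w * z / 16
        + (u ^ 2 * (v * w + v * z + w * z) + v ^ 2 * (u * w + u * z + w * z)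
          + w ^ 2 * (u * v + u * z + v * z) + z ^ 2 * (u * v + u * w + v * w)) / 48
        + (u ^ 2 * v ^ 2 + u ^ 2 * w ^ 2 + u ^ 2 * z ^ 2 + v ^ 2 * w ^ 2 + v ^ 2 * z ^ 2
          + w ^ 2 * z ^ 2) / 144
        - (u ^ 4 + v ^ 4 + w ^ 4 + z ^ 4) / 720) : ℝ) : ℂ) := by
    simp only [quarticCoeff, cauchyProd, Finset.sum_range_succ, Finset.sum_range_zero,
      Nat.reduceSub, zero_add, expCoeff, toddCoeff, Nat.factorial]
    push_cast
    ring
  rw [e, ← Complex.ofReal_mul, ← Complex.ofReal_mul, ← Complex.ofReal_mul, ← Complex.ofReal_div]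
  congr 1
  field_simp
  ring

/-! ### The sawtooth function -/

lemma latticeCount_cons_eq_sum {a : ℝ} {t : List ℝ} (hpos : ∀ ℓ ∈ a :: t, 0 < ℓ) {y : ℝ}
    {M : ℕ} (hM : y < M * a) :
    latticeCount (a :: t) y = ∑ n ∈ Finset.range M, latticeCount t (y - n * a) := by
  rw [latticeCount]
  exact tsum_eq_sum fun n hn => latticeCount_eq_zero_of_lt hpos hM hn

/-- The count is `⌊y / u⌋ + 1`, less `1 / 2` when `y / u` is an integer and the last multiple of `u`
hits `y`. -/
lemma latticeCount_singleton {u y : ℝ} (hu : 0 < u) (hy : 0 ≤ y) :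
    latticeCount [u] y = y / u + 1 / 2 - B1star (y / u) := by
  have hpos : ∀ ℓ ∈ [u], 0 < ℓ := by simpa using hu
  set m := ⌊y / u⌋₊ with hm
  have h1 : (m : ℝ) ≤ y / u := Nat.floor_le (by positivity)
  have h2 : y / u < m + 1 := Nat.lt_floor_add_one _
  have h1' : m * u ≤ y := (le_div_iff₀ hu).1 h1
  have h2' : y < ((m + 1 : ℕ) : ℝ) * u := by push_cast; exact (div_lt_iff₀ hu).1 h2
  have hfract : Int.fract (y / u) = y / u - m := by
    rw [Int.fract_eq_iff]
    exact ⟨by linarith, by linarith, m, by push_cast; ring⟩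
  have hlow : ∑ n ∈ Finset.range m, latticeCount [] (y - n * u) = m := by
    rw [Finset.sum_congr rfl (g := fun _ => (1 : ℝ))]
    · simp
    · intro n hn
      have : (n : ℝ) + 1 ≤ m := by exact_mod_cast Finset.mem_range.1 hn
      have : 0 < y - n * u := by nlinarith
      simp [latticeCount, stepHalf, this.not_gt, this.ne']
  rw [latticeCount_cons_eq_sum hpos h2', Finset.sum_range_succ, hlow, B1star]
  by_cases h : y / u = m
  · have h3 : y - m * u = 0 := by rw [← h, div_mul_cancel₀ _ hu.ne', sub_self]
    rw [if_pos ⟨(m : ℤ), by rw [h]; push_cast; rfl⟩, h, h3]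
    norm_num [latticeCount, stepHalf]
  · have h3 : 0 < y - m * u := by
      have := lt_of_le_of_ne h1 (Ne.symm h)
      have := (lt_div_iff₀ hu).1 this
      linarith
    rw [if_neg, hfract]
    · simp only [latticeCount, stepHalf, h3.not_gt, h3.ne', if_false]
      ring
    · rintro ⟨k, hk⟩
      have hk : (k : ℝ) = y / u := hk
      rw [← hk, Int.fract_intCast] at hfract
      exact h (by linarith)

lemma tendsto_sinSum_B1star {l : Filter ℝ} {y : ℝ} (hl : l ≤ atTop) {u : ℝ} (hu : 0 < u)
    (hI : AvoidsIntegers l u) (hy : 0 ≤ y) :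
    Tendsto (sinSum u y) l (𝓝 (-π * B1star (y / u))) := by
  have := tendsto_sinSum hl hu hI hy
  rw [latticeCount_singleton hu hy] at this
  convert this using 2
  ring

/-! ### Admissible cut-offs -/

/-- The points `k / u` are at least `2 * h` apart. If one of them lies near the left half of `[x, x
+ h]`, the last quarter of the interval is free of them with margin `h / 4`; otherwise the first
quarter is. -/
lemma exists_subinterval {u h : ℝ} (hu : 0 < u) (hh : 0 < h) (hhu : 2 * h * u ≤ 1) (x : ℝ) :
    ∃ x', x ≤ x' ∧ x' + h / 4 ≤ x + h ∧
      ∀ r, x' ≤ r → r ≤ x' + h / 4 → ∀ k : ℕ, h / 4 ≤ |r - k / u| := by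
  have hsep : ∀ j k : ℕ, j ≠ k → 2 * h ≤ |(j : ℝ) / u - k / u| := by
    intro j k hjk
    have h1 : (1 : ℝ) ≤ |(j : ℝ) - k| := by
      have : (1 : ℤ) ≤ |(j : ℤ) - k| := Int.one_le_abs (sub_ne_zero.2 (by exact_mod_cast hjk))
      exact_mod_cast this
    rw [← sub_div, abs_div, abs_of_pos hu, le_div_iff₀ hu]
    linarith
  by_cases hleft : ∃ k : ℕ, x - h / 4 < (k : ℝ) / u ∧ (k : ℝ) / u < x + h / 2
  · obtain ⟨k, hk1, hk2⟩ := hleft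
    refine ⟨x + 3 * h / 4, by linarith, by linarith, fun r h1 h2 j => ?_⟩
    rcases eq_or_ne j k with rfl | hjk
    · exact (by linarith : h / 4 ≤ r - j / u).trans (le_abs_self _)
    · have := hsep j k hjk
      by_contra! hlt
      rw [abs_lt] at hlt
      rcases le_abs.1 this with h3 | h3 <;> linarith
  · push Not at hleft
    refine ⟨x, le_rfl, by linarith, fun r h1 h2 j => ?_⟩
    rcases le_or_gt ((j : ℝ) / u) (x - h / 4) with h3 | h3
    · exact (by linarith : h / 4 ≤ r - j / u).trans (le_abs_self _)
    · exact (by linarith [hleft j h3] : h / 4 ≤ -(r - j / u)).trans (neg_le_abs _)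

/-- For small distances the admissible cut-off parameters are unbounded. -/
lemma cutoffFilter_neBot {a b c d : ℕ} (ha : 0 < log a) (hb : 0 < log b) (hc : 0 < log c)
    (hd : 0 < log d) : ∃ δ₀ > 0, ∀ δ ≤ δ₀, (cutoffFilter a b c d δ).NeBot := by
  set m := log a + log b + log c + log d with hm
  set h := 1 / (2 * m) with hh
  have hmpos : 0 < m := by positivity
  have hpos : 0 < h := by positivity
  have hle : ∀ (u g : ℝ), u ≤ m → 0 ≤ u → 0 ≤ g → g ≤ h → 2 * g * u ≤ 1 := by
    intro u g h1 h2 h3 h4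
    calc 2 * g * u ≤ 2 * h * m := by
          apply mul_le_mul _ h1 h2 (by positivity)
          linarith
      _ = 1 := by rw [hh]; field_simp
  -- The factor `256 = 4 ^ 4` stems from four successive quarterings, one for each base.
  refine ⟨h / 256, by positivity, fun δ hδ => ?_⟩
  rw [cutoffFilter, Filter.inf_principal_neBot_iff]
  intro U hU
  obtain ⟨X, hX⟩ := mem_atTop_sets.1 hU
  obtain ⟨x1, p1, q1, r1⟩ := exists_subinterval ha hpos (hle _ _ (by linarith) ha.le hpos.le le_rfl) X
  obtain ⟨x2, p2, q2, r2⟩ := exists_subinterval hb (show 0 < h / 4 by positivity)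
    (hle _ _ (by linarith) hb.le (by positivity) (by linarith)) x1
  obtain ⟨x3, p3, q3, r3⟩ := exists_subinterval hc (show 0 < h / 4 / 4 by positivity)
    (hle _ _ (by linarith) hc.le (by positivity) (by linarith)) x2
  obtain ⟨x4, p4, q4, r4⟩ := exists_subinterval hd (show 0 < h / 4 / 4 / 4 by positivity)
    (hle _ _ (by linarith) hd.le (by positivity) (by linarith)) x3
  refine ⟨x4, hX _ (by linarith), ?_⟩
  intro u hu k
  simp only [Set.mem_insert_iff, Set.mem_singleton_iff] at hu
  rcases hu with rfl | rfl | rfl | rfl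
  · linarith [r1 x4 (by linarith) (by linarith) k]
  · linarith [r2 x4 (by linarith) (by linarith) k]
  · linarith [r3 x4 (by linarith) (by linarith) k]
  · linarith [r4 x4 (by linarith) (by linarith) k]

/-- Periodicity reduces `t` to its signed distance `r` from the nearest integer, and there `1 - cos
(2πr) ≥ 8r²`. -/
lemma one_sub_cos_two_pi_ge {t ε : ℝ} (hε : 0 ≤ ε) (h : ∀ k : ℤ, ε ≤ |t - k|) :
    8 * ε ^ 2 ≤ 1 - cos (2 * π * t) := by
  set r := t - round t with hr
  have h1 : |r| ≤ 1 / 2 := abs_sub_round t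
  have h2 : ε ≤ |r| := h _
  have e : cos (2 * π * t) = cos (2 * π * r) := by
    rw [← Real.cos_sub_int_mul_two_pi (2 * π * t) (round t)]
    congr 1
    rw [hr]
    ring
  have h3 := Real.cos_le_one_sub_mul_cos_sq (x := 2 * π * r) (by
    rw [abs_mul, abs_of_pos (by positivity : 0 < 2 * π)]
    nlinarith [pi_pos])
  have h4 : 2 / π ^ 2 * (2 * π * r) ^ 2 = 8 * r ^ 2 := by
    field_simp
    ring
  have h5 : ε ^ 2 ≤ r ^ 2 := by rw [← sq_abs r]; gcongr
  rw [e]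
  linarith

lemma avoidsIntegers_cutoffFilter {a b c d : ℕ} {δ : ℝ} (hδ : 0 < δ) {u : ℕ}
    (hu : u ∈ ({a, b, c, d} : Set ℕ)) (hlog : 0 < log u) :
    AvoidsIntegers (cutoffFilter a b c d δ) (log u) := by
  refine ⟨8 * (δ * log u) ^ 2, by positivity, ?_⟩
  have h1 : ∀ᶠ R in cutoffFilter a b c d δ, R ∈ goodCutoffs a b c d δ :=
    mem_inf_of_right (mem_principal_self _)
  have h2 : ∀ᶠ R in cutoffFilter a b c d δ, δ ≤ R :=
    mem_inf_of_left (eventually_ge_atTop δ)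
  filter_upwards [h1, h2] with R g1 g2
  rw [mul_assoc (2 * π)]
  refine one_sub_cos_two_pi_ge (by positivity) fun k => ?_
  rcases le_or_gt 0 k with hk | hk
  · lift k to ℕ using hk
    have := g1 u hu k
    have e : R * log u - ((k : ℕ) : ℤ) = (R - k / log u) * log u := by
      push_cast
      field_simp
    rw [e, abs_mul, abs_of_pos hlog]
    gcongr
  -- The set `goodCutoffs` concerns only `k ≥ 0`; for negative `k` it is enough that `R ≥ δ`.
  · refine le_trans ?_ (le_abs_self _)
    have : (k : ℝ) ≤ 0 := by exact_mod_cast hk.le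
    nlinarith

/-! ### From lattice points to the counting function -/

lemma log_monomial {a b c d : ℕ} (ha : a ≠ 0) (hb : b ≠ 0) (hc : c ≠ 0) (hd : d ≠ 0)
    (e : ℕ × ℕ × ℕ × ℕ) : log (monomial a b c d e)
      = e.1 * log a + e.2.1 * log b + e.2.2.1 * log c + e.2.2.2 * log d := by
  have ha' : (a : ℝ) ≠ 0 := by exact_mod_cast ha
  have hb' : (b : ℝ) ≠ 0 := by exact_mod_cast hb
  have hc' : (c : ℝ) ≠ 0 := by exact_mod_cast hc
  have hd' : (d : ℝ) ≠ 0 := by exact_mod_cast hd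
  rw [monomial]
  push_cast
  rw [Real.log_mul (by positivity) (by positivity), Real.log_mul (by positivity) (by positivity),
    Real.log_mul (by positivity) (by positivity), Real.log_pow, Real.log_pow, Real.log_pow,
    Real.log_pow]

/-- The step function is the indicator of `≤` minus half the indicator of `=`. Over all exponents
the first sums to `N`; the second sums to `χ`, because a value is attained by at most one quadruple.
-/
lemma latticeCount_eq_N_sub_chi {a b c d : ℕ} (ha : 2 ≤ a) (hb : 2 ≤ b) (hc : 2 ≤ c) (hd : 2 ≤ d)
    (hinj : Function.Injective (monomial a b c d)) {x : ℝ} (hx : 1 ≤ x) :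
    latticeCount [log a, log b, log c, log d] (log x)
      = N a b c d x - 1 / 2 * chi a b c d x := by
  classical
  have hlog : ∀ u : ℕ, 2 ≤ u → 0 < log u := fun u hu => Real.log_pos (by exact_mod_cast hu)
  have la := hlog a ha
  have lb := hlog b hb
  have lc := hlog c hc
  have ld := hlog d hd
  have hxpos : 0 < x := one_pos.trans_le hx
  have hmpos : ∀ e, 0 < (monomial a b c d e : ℝ) := fun e => by
    have : 0 < monomial a b c d e := by unfold monomial; positivity
    exact_mod_cast this
  have hy : 0 ≤ log x := Real.log_nonneg hx
  -- One bound for all four exponents, so that every sum runs over the same finite box.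
  have hM : ∃ M : ℕ, ∀ u ∈ [log a, log b, log c, log d], log x < M * u := by
    set m := min (min (log a) (log b)) (min (log c) (log d)) with hm
    have hmpos : 0 < m := lt_min (lt_min la lb) (lt_min lc ld)
    obtain ⟨M, hM⟩ := exists_nat_gt (log x / m)
    rw [div_lt_iff₀ hmpos] at hM
    refine ⟨M, fun u hu => hM.trans_le ?_⟩
    refine mul_le_mul_of_nonneg_left ?_ M.cast_nonneg
    simp only [List.mem_cons, List.not_mem_nil, or_false] at hu
    rcases hu with rfl | rfl | rfl | rfl <;> simp [hm]
  obtain ⟨M, hM⟩ := hM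
  set box : Finset (ℕ × ℕ × ℕ × ℕ) :=
    Finset.range M ×ˢ Finset.range M ×ˢ Finset.range M ×ˢ Finset.range M with hbox
  have hstep : ∀ e : ℕ × ℕ × ℕ × ℕ, stepHalf (log x - e.1 * log a - e.2.1 * log b
      - e.2.2.1 * log c - e.2.2.2 * log d) = (if (monomial a b c d e : ℝ) ≤ x then 1 else 0)
        - 1 / 2 * if (monomial a b c d e : ℝ) = x then 1 else 0 := fun e => by
    have h1 := log_monomial (by omega : a ≠ 0) (by omega : b ≠ 0) (by omega : c ≠ 0)
      (by omega : d ≠ 0) e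
    have h2 : log x - e.1 * log a - e.2.1 * log b - e.2.2.1 * log c - e.2.2.2 * log d
        = log x - log (monomial a b c d e) := by rw [h1]; ring
    rw [h2, stepHalf]
    rcases lt_trichotomy (monomial a b c d e : ℝ) x with h | h | h
    · have := Real.log_lt_log (hmpos e) h
      rw [if_neg (by linarith), if_neg (by linarith), if_pos h.le, if_neg h.ne]
      norm_num
    · rw [h]; norm_num
    · have := Real.log_lt_log hxpos h
      rw [if_pos (by linarith), if_neg h.not_ge, if_neg h.ne']
      norm_num
  have hmem : ∀ e, (monomial a b c d e : ℝ) ≤ x → e ∈ box := fun e he => by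
    have h1 := Real.log_le_log (hmpos e) he
    rw [log_monomial (by omega : a ≠ 0) (by omega : b ≠ 0) (by omega : c ≠ 0)
      (by omega : d ≠ 0) e] at h1
    have t1 : 0 ≤ (e.1 : ℝ) * log a := by positivity
    have t2 : 0 ≤ (e.2.1 : ℝ) * log b := by positivity
    have t3 : 0 ≤ (e.2.2.1 : ℝ) * log c := by positivity
    have t4 : 0 ≤ (e.2.2.2 : ℝ) * log d := by positivity
    have aux : ∀ (n : ℕ) (u : ℝ), 0 < u → n * u ≤ log x → log x < M * u → n < M := by
      intro n u hu h2 h3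
      have := lt_of_mul_lt_mul_right (h2.trans_lt h3) hu.le
      exact_mod_cast this
    simp only [hbox, Finset.mem_product, Finset.mem_range]
    exact ⟨aux _ _ la (by linarith) (hM _ (by simp)), aux _ _ lb (by linarith) (hM _ (by simp)),
      aux _ _ lc (by linarith) (hM _ (by simp)), aux _ _ ld (by linarith) (hM _ (by simp))⟩
  have hsum : latticeCount [log a, log b, log c, log d] (log x)
      = ∑ e ∈ box, stepHalf (log x - e.1 * log a - e.2.1 * log b
        - e.2.2.1 * log c - e.2.2.2 * log d) := by
    have sub : ∀ (n : ℕ) (u v y : ℝ), 0 < u → y < v → y - n * u < v := fun n u v y hu h => by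
      have : 0 ≤ (n : ℝ) * u := by positivity
      linarith
    simp only [hbox, Finset.sum_product]
    rw [latticeCount_cons_eq_sum (by simp [la, lb, lc, ld]) (hM _ (by simp))]
    refine Finset.sum_congr rfl fun p _ => ?_
    have hb' := sub p _ _ _ la (hM (log b) (by simp))
    have hc' := sub p _ _ _ la (hM (log c) (by simp))
    have hd' := sub p _ _ _ la (hM (log d) (by simp))
    rw [latticeCount_cons_eq_sum (by simp [lb, lc, ld]) hb']
    refine Finset.sum_congr rfl fun q _ => ?_
    have hc' := sub q _ _ _ lb hc'
    have hd' := sub q _ _ _ lb hd'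
    rw [latticeCount_cons_eq_sum (by simp [lc, ld]) hc']
    refine Finset.sum_congr rfl fun r _ => ?_
    have hd' := sub r _ _ _ lc hd'
    rw [latticeCount_cons_eq_sum (by simp [ld]) hd']
    rfl
  have hN : (N a b c d x : ℝ) = ∑ e ∈ box, if (monomial a b c d e : ℝ) ≤ x then (1 : ℝ) else 0 := by
    have : {e : ℕ × ℕ × ℕ × ℕ | (monomial a b c d e : ℝ) ≤ x}
        = (box.filter fun e => (monomial a b c d e : ℝ) ≤ x : Finset _) := by
      ext e
      simp only [Set.mem_ofPred_eq, Finset.coe_filter]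
      exact ⟨fun h => ⟨hmem e h, h⟩, fun h => h.2⟩
    rw [N, this, Set.ncard_coe_finset, Finset.sum_boole]
  have hchi : chi a b c d x = ∑ e ∈ box, if (monomial a b c d e : ℝ) = x then (1 : ℝ) else 0 := by
    by_cases hxS : x ∈ S a b c d
    · obtain ⟨e, he⟩ := hxS
      have he : (monomial a b c d e : ℝ) = x := he
      rw [chi, Set.indicator_of_mem (show x ∈ S a b c d from ⟨e, he⟩), Finset.sum_eq_single e, if_pos he]
      · intro e' _ hne
        refine if_neg fun h => hne (hinj ?_)
        rw [← he] at h
        exact_mod_cast h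
      · exact fun h => absurd (hmem e he.le) h
    · rw [chi, Set.indicator_of_notMem hxS]
      refine (Finset.sum_eq_zero fun e _ => if_neg fun h => hxS ⟨e, h⟩).symm
  rw [hsum, hN, hchi, Finset.mul_sum, ← Finset.sum_sub_distrib]
  exact Finset.sum_congr rfl fun e _ => hstep e

/-! ### The stated series in terms of cotangents -/

/-- The shift by half a logarithm yields `cos (θ - β) / sin β = cos θ cot β + sin θ`, a cotangent
term plus a sawtooth term. -/
lemma pairSum_eq {u v x R : ℝ} (huv : ∀ k : ℕ, k ≠ 0 → sin (π * k * log v / log u) ≠ 0)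
    (hvu : ∀ k : ℕ, k ≠ 0 → sin (π * k * log u / log v) ≠ 0) :
    pairSum u v x R = (cosCotSum (log u) (log v) (log x) R + cosCotSum (log v) (log u) (log x) R)
      + (sinSum (log u) (log x) R + sinSum (log v) (log x) R) := by
  have key : ∀ p q y : ℝ, (∀ k : ℕ, k ≠ 0 → sin (π * k * q / p) ≠ 0) →
      ∑ k ∈ Finset.Icc 1 ⌊R * p⌋₊, cos (2 * π * k * ((y - 1 / 2 * q) / p))
        / (k * sin (π * k * q / p)) = cosCotSum p q y R + sinSum p y R := by
    intro p q y h
    rw [cosCotSum, sinSum, ← Finset.sum_add_distrib]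
    refine Finset.sum_congr rfl fun k hk => ?_
    have hk0 : k ≠ 0 := by have := (Finset.mem_Icc.1 hk).1; omega
    have h1 := h k hk0
    have hk' : (k : ℝ) ≠ 0 := by exact_mod_cast hk0
    have e : 2 * π * k * ((y - 1 / 2 * q) / p) = 2 * π * k * (y / p) - π * k * q / p := by ring
    rw [e, Real.cos_sub, cotRatio]
    generalize sin (π * k * q / p) = s at *
    field_simp
  rw [pairSum, key _ _ _ huv, key _ _ _ hvu]
  ring

/-- The two numerators add to `2 sin θ cos (β - γ)`, and division by `sin β sin γ` leaves `2 sin θ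
(cot β cot γ + 1)`. -/
lemma doubleSineSum_eq {u v w x R : ℝ} (huv : ∀ k : ℕ, k ≠ 0 → sin (π * k * log v / log u) ≠ 0)
    (huw : ∀ k : ℕ, k ≠ 0 → sin (π * k * log w / log u) ≠ 0) :
    doubleSineSum u v w x R
      = 2 * sinCotCotSum (log u) (log v) (log w) (log x) R + 2 * sinSum (log u) (log x) R := by
  rw [doubleSineSum, sinCotCotSum, sinSum, Finset.mul_sum, Finset.mul_sum,
    ← Finset.sum_add_distrib]
  refine Finset.sum_congr rfl fun k hk => ?_
  have hk0 : k ≠ 0 := by have := (Finset.mem_Icc.1 hk).1; omega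
  have h1 := huv k hk0
  have h2 := huw k hk0
  have hk' : (k : ℝ) ≠ 0 := by exact_mod_cast hk0
  have e1 : 2 * π * k * ((log x + 1 / 2 * log v - 1 / 2 * log w) / log u)
      = 2 * π * k * (log x / log u) + (π * k * log v / log u - π * k * log w / log u) := by ring
  have e2 : 2 * π * k * ((log x - 1 / 2 * log v + 1 / 2 * log w) / log u)
      = 2 * π * k * (log x / log u) - (π * k * log v / log u - π * k * log w / log u) := by ring
  rw [e1, e2, Real.sin_add, Real.sin_sub (2 * π * k * (log x / log u)), Real.cos_sub, cotRatio,
    cotRatio]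
  generalize sin (π * k * log v / log u) = s at *
  generalize sin (π * k * log w / log u) = t at *
  field_simp
  ring

lemma tripleCotSum_eq (u v w z x R : ℝ) :
    tripleCotSum u v w z x R
      = cosCotCotCotSum (log u) (log v) (log w) (log z) (log x) R := by
  rw [tripleCotSum, cosCotCotCotSum]
  refine Finset.sum_congr rfl fun k _ => ?_
  rw [cotRatio, cotRatio, cotRatio]
  simp only [div_eq_mul_inv, mul_inv]
  ring

/-! ### Separate convergence of pairs and triples -/

section

variable {ι : Type*} {L : ι → ℝ} {y : ℝ}

/-- Perron's formula for the two periods controls these series together with two sawtooth series,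
which converge by themselves and can be removed. -/
lemma exists_tendsto_cosCotSum_pair (hpos : ∀ i, 0 < L i) (h : Incommensurable L) (hy : 0 ≤ y)
    {i j : ι} (hij : i ≠ j) : ∃ p : ℝ, ∀ l : Filter ℝ, l ≤ atTop →
      (∀ i, AvoidsIntegers l (L i)) →
      Tendsto (fun R => cosCotSum (L i) (L j) y R + cosCotSum (L j) (L i) y R) l (𝓝 p) := by
  have hσ : Function.Injective ![i, j] := by
    intro p q hpq
    fin_cases p <;> fin_cases q <;> simp_all
  obtain ⟨A, hA⟩ := exists_tendsto_two (ℓ := L ∘ ![i, j]) (fun _ => hpos _) (h.comp hσ) hy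
  refine ⟨-π * B1star (y / L i) + -π * B1star (y / L j) - A, fun l hl hI => ?_⟩
  have h1 := hA l hl fun _ => hI _
  have h2 := (tendsto_sinSum_B1star hl (hpos i) (hI i) hy).add
    (tendsto_sinSum_B1star hl (hpos j) (hI j) hy)
  refine (h2.sub h1).congr fun R => ?_
  simp
  ring

/-- From the limit for three periods one removes the three sawtooth series and the three pairs
already known to converge. -/
lemma exists_tendsto_sinCotCotSum_triple (hpos : ∀ i, 0 < L i) (h : Incommensurable L)
    (hy : 0 ≤ y) {i j m : ι} (hij : i ≠ j) (him : i ≠ m) (hjm : j ≠ m) :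
    ∃ t : ℝ, ∀ l : Filter ℝ, l ≤ atTop → (∀ i, AvoidsIntegers l (L i)) →
      Tendsto (fun R => sinCotCotSum (L i) (L j) (L m) y R + sinCotCotSum (L j) (L i) (L m) y R
        + sinCotCotSum (L m) (L i) (L j) y R) l (𝓝 t) := by
  have hσ : Function.Injective ![i, j, m] := by
    intro p q hpq
    fin_cases p <;> fin_cases q <;> simp_all
  obtain ⟨A, hA⟩ := exists_tendsto_three (ℓ := L ∘ ![i, j, m]) (fun _ => hpos _) (h.comp hσ) hy
  obtain ⟨p, hp⟩ := exists_tendsto_cosCotSum_pair hpos h hy hij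
  obtain ⟨q, hq⟩ := exists_tendsto_cosCotSum_pair hpos h hy him
  obtain ⟨r, hr⟩ := exists_tendsto_cosCotSum_pair hpos h hy hjm
  refine ⟨-π * B1star (y / L i) + -π * B1star (y / L j) + -π * B1star (y / L m) - A - p - (q + r),
    fun l hl hI => ?_⟩
  have h1 := hA l hl fun _ => hI _
  have h2 := ((tendsto_sinSum_B1star hl (hpos i) (hI i) hy).add
    (tendsto_sinSum_B1star hl (hpos j) (hI j) hy)).add
    (tendsto_sinSum_B1star hl (hpos m) (hI m) hy)
  refine (((h2.sub h1).sub (hp l hl hI)).sub ((hq l hl hI).add (hr l hl hI))).congr fun R => ?_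
  simp
  ring

end

/-! ### Multiplicative independence of the bases -/

/-- Unique factorization forces the bases to be at least two. -/
lemma two_le_of_injective_monomial {a b c d : ℕ} (hinj : Function.Injective (monomial a b c d)) :
    2 ≤ a := by
  have h0 : a ≠ 0 := by
    rintro rfl
    have := @hinj (1, 0, 0, 0) (2, 0, 0, 0) (by simp [monomial])
    simp at this
  have h1 : a ≠ 1 := by
    rintro rfl
    have := @hinj (1, 0, 0, 0) (2, 0, 0, 0) (by simp [monomial])
    simp at this
  omega

/-- Absolute values remove the signs of the multipliers, and exponentiating turns an equality into
`u ^ |k| = v ^ |m|`. -/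
lemma mul_log_ne_mul_log {u v : ℕ} (hu : 2 ≤ u) (hv : 2 ≤ v)
    (h : ∀ k m : ℕ, u ^ k = v ^ m → k = 0) {k m : ℤ} (hk : k ≠ 0) :
    (k : ℝ) * log u ≠ m * log v := fun he => by
  have lu : 0 < log u := Real.log_pos (by exact_mod_cast hu)
  have lv : 0 < log v := Real.log_pos (by exact_mod_cast hv)
  have h1 : (k.natAbs : ℝ) * log u = m.natAbs * log v := by
    rw [Nat.cast_natAbs, Nat.cast_natAbs, Int.cast_abs, Int.cast_abs]
    have := congrArg abs he
    rwa [abs_mul, abs_mul, abs_of_pos lu, abs_of_pos lv] at this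
  rw [← Real.log_pow, ← Real.log_pow] at h1
  have hu0 : (0 : ℝ) < u := by exact_mod_cast (by omega : 0 < u)
  have hv0 : (0 : ℝ) < v := by exact_mod_cast (by omega : 0 < v)
  have h2 := Real.log_injOn_pos (Set.mem_Ioi.2 (pow_pos hu0 _)) (Set.mem_Ioi.2 (pow_pos hv0 _)) h1
  have := h k.natAbs m.natAbs (by exact_mod_cast h2)
  omega

lemma incommensurable_log {a b c d : ℕ} (ha : 2 ≤ a) (hb : 2 ≤ b) (hc : 2 ≤ c) (hd : 2 ≤ d)
    (hinj : Function.Injective (monomial a b c d)) :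
    Incommensurable (fun i => log ((![a, b, c, d] : Fin 4 → ℕ) i)) := by
  intro i j hij k m hk
  have h2 : ∀ i, 2 ≤ (![a, b, c, d] : Fin 4 → ℕ) i := by
    intro i; fin_cases i <;> simpa
  refine mul_log_ne_mul_log (h2 i) (h2 j) (fun p q hpq => ?_) hk
  -- `E i n` is the exponent quadruple of the `n`th power of the `i`th base. For `i ≠ j` the
  -- quadruples `E i p` and `E j q` agree only if `p = 0`.
  set E : Fin 4 → ℕ → ℕ × ℕ × ℕ × ℕ :=
    ![fun n => (n, 0, 0, 0), fun n => (0, n, 0, 0), fun n => (0, 0, n, 0), fun n => (0, 0, 0, n)]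
    with hE
  have hmon : ∀ i n, monomial a b c d (E i n) = (![a, b, c, d] : Fin 4 → ℕ) i ^ n := by
    intro i n; fin_cases i <;> simp [hE, monomial]
  have := hinj (a₁ := E i p) (a₂ := E j q) (by rw [hmon, hmon, hpq])
  fin_cases i <;> fin_cases j <;> simp_all

end SmoothCount

/-! ### The formula for four bases -/

theorem theorem9 (a b c d : ℕ) (hab : a < b) (hbc : b < c) (hcd : c < d)
    (hgcd : Nat.gcd a (Nat.gcd b (Nat.gcd c d)) = 1)
    (hunique : Function.Injective (SmoothCount.monomial a b c d)) :
    -- for small distances, the limits below run through arbitrarily large cut-offs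
    (∃ δ₀ > 0, ∀ δ ≤ δ₀, (SmoothCount.cutoffFilter a b c d δ).NeBot) ∧
    ∀ x : ℝ, 1 ≤ x →
      ∃ Pab Pac Pad Pbc Pbd Pcd Tabc Tabd Tacd Tbcd Q : ℝ,
        -- the values of the series
        (∀ δ > 0,
          Tendsto (SmoothCount.pairSum a b x) (SmoothCount.cutoffFilter a b c d δ) (𝓝 Pab) ∧
          Tendsto (SmoothCount.pairSum a c x) (SmoothCount.cutoffFilter a b c d δ) (𝓝 Pac) ∧
          Tendsto (SmoothCount.pairSum a d x) (SmoothCount.cutoffFilter a b c d δ) (𝓝 Pad) ∧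
          Tendsto (SmoothCount.pairSum b c x) (SmoothCount.cutoffFilter a b c d δ) (𝓝 Pbc) ∧
          Tendsto (SmoothCount.pairSum b d x) (SmoothCount.cutoffFilter a b c d δ) (𝓝 Pbd) ∧
          Tendsto (SmoothCount.pairSum c d x) (SmoothCount.cutoffFilter a b c d δ) (𝓝 Pcd) ∧
          Tendsto (SmoothCount.doubleSineTriple a b c x)
            (SmoothCount.cutoffFilter a b c d δ) (𝓝 Tabc) ∧
          Tendsto (SmoothCount.doubleSineTriple a b d x)
            (SmoothCount.cutoffFilter a b c d δ) (𝓝 Tabd) ∧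
          Tendsto (SmoothCount.doubleSineTriple a c d x)
            (SmoothCount.cutoffFilter a b c d δ) (𝓝 Tacd) ∧
          Tendsto (SmoothCount.doubleSineTriple b c d x)
            (SmoothCount.cutoffFilter a b c d δ) (𝓝 Tbcd) ∧
          Tendsto (SmoothCount.tripleCotQuadruple a b c d x)
            (SmoothCount.cutoffFilter a b c d δ) (𝓝 Q)) ∧
        (SmoothCount.N a b c d x : ℝ) =
          SmoothCount.mainPoly a b c d x
            - 7 / 8 * SmoothCount.B1star (log x / log a)
            - 7 / 8 * SmoothCount.B1star (log x / log b)
            - 7 / 8 * SmoothCount.B1star (log x / log c)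
            - 7 / 8 * SmoothCount.B1star (log x / log d)
            - 1 / (8 * π) * (Pab + Pac + Pad + Pbc + Pbd + Pcd)
            - 1 / (16 * π) * (Tabc + Tabd + Tacd + Tbcd)
            + 1 / (8 * π) * Q
            + 1 / 2 * SmoothCount.chi a b c d x := by
  have ha : 2 ≤ a := SmoothCount.two_le_of_injective_monomial hunique
  have hb : 2 ≤ b := by omega
  have hc : 2 ≤ c := by omega
  have hd : 2 ≤ d := by omega
  have hlog : ∀ u : ℕ, 2 ≤ u → 0 < log u := fun u hu => Real.log_pos (by exact_mod_cast hu)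
  have la := hlog a ha
  have lb := hlog b hb
  have lc := hlog c hc
  have ld := hlog d hd
  refine ⟨SmoothCount.cutoffFilter_neBot la lb lc ld, fun x hx => ?_⟩
  have hy : 0 ≤ log x := Real.log_nonneg hx
  set L : Fin 4 → ℝ := fun i => log ((![a, b, c, d] : Fin 4 → ℕ) i) with hL
  have hpos : ∀ i, 0 < L i := by
    intro i; fin_cases i <;> simpa [hL]
  have hinc : SmoothCount.Incommensurable L :=
    SmoothCount.incommensurable_log ha hb hc hd hunique
  have L0 : L 0 = log a := rfl
  have L1 : L 1 = log b := rfl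
  have L2 : L 2 = log c := rfl
  have L3 : L 3 = log d := rfl
  have hsin : ∀ i j : Fin 4, j ≠ i → ∀ k : ℕ, k ≠ 0 → sin (π * k * L j / L i) ≠ 0 :=
    fun i j hij k hk => hinc.sin_ne_zero hpos hij hk
  obtain ⟨p01, h01⟩ := SmoothCount.exists_tendsto_cosCotSum_pair hpos hinc hy
    (show (0 : Fin 4) ≠ 1 by decide)
  obtain ⟨p02, h02⟩ := SmoothCount.exists_tendsto_cosCotSum_pair hpos hinc hy
    (show (0 : Fin 4) ≠ 2 by decide)
  obtain ⟨p03, h03⟩ := SmoothCount.exists_tendsto_cosCotSum_pair hpos hinc hy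
    (show (0 : Fin 4) ≠ 3 by decide)
  obtain ⟨p12, h12⟩ := SmoothCount.exists_tendsto_cosCotSum_pair hpos hinc hy
    (show (1 : Fin 4) ≠ 2 by decide)
  obtain ⟨p13, h13⟩ := SmoothCount.exists_tendsto_cosCotSum_pair hpos hinc hy
    (show (1 : Fin 4) ≠ 3 by decide)
  obtain ⟨p23, h23⟩ := SmoothCount.exists_tendsto_cosCotSum_pair hpos hinc hy
    (show (2 : Fin 4) ≠ 3 by decide)
  obtain ⟨t012, h012⟩ := SmoothCount.exists_tendsto_sinCotCotSum_triple hpos hinc hy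
    (show (0 : Fin 4) ≠ 1 by decide) (show (0 : Fin 4) ≠ 2 by decide)
    (show (1 : Fin 4) ≠ 2 by decide)
  obtain ⟨t013, h013⟩ := SmoothCount.exists_tendsto_sinCotCotSum_triple hpos hinc hy
    (show (0 : Fin 4) ≠ 1 by decide) (show (0 : Fin 4) ≠ 3 by decide)
    (show (1 : Fin 4) ≠ 3 by decide)
  obtain ⟨t023, h023⟩ := SmoothCount.exists_tendsto_sinCotCotSum_triple hpos hinc hy
    (show (0 : Fin 4) ≠ 2 by decide) (show (0 : Fin 4) ≠ 3 by decide)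
    (show (2 : Fin 4) ≠ 3 by decide)
  obtain ⟨t123, h123⟩ := SmoothCount.exists_tendsto_sinCotCotSum_triple hpos hinc hy
    (show (1 : Fin 4) ≠ 2 by decide) (show (1 : Fin 4) ≠ 3 by decide)
    (show (2 : Fin 4) ≠ 3 by decide)
  set σ : Fin 4 → ℝ := fun i => -π * SmoothCount.B1star (log x / L i) with hσ
  -- Each pair or triple value is the cotangent limit plus the sawtooth limits from the addition
  -- formulas. The last witness is the formula of the theorem solved for `Q`; what remains to be
  -- shown for it is convergence.
  refine ⟨p01 + (σ 0 + σ 1), p02 + (σ 0 + σ 2), p03 + (σ 0 + σ 3), p12 + (σ 1 + σ 2),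
    p13 + (σ 1 + σ 3), p23 + (σ 2 + σ 3), 2 * t012 + 2 * (σ 0 + σ 1 + σ 2),
    2 * t013 + 2 * (σ 0 + σ 1 + σ 3), 2 * t023 + 2 * (σ 0 + σ 2 + σ 3),
    2 * t123 + 2 * (σ 1 + σ 2 + σ 3),
    8 * π * (SmoothCount.N a b c d x - 1 / 2 * SmoothCount.chi a b c d x
      - SmoothCount.mainPoly a b c d x) - (σ 0 + σ 1 + σ 2 + σ 3)
      + (t012 + t013 + t023 + t123) + (p01 + p02 + p03 + p12 + p13 + p23), fun δ hδ => ?_, ?_⟩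
  · set l := SmoothCount.cutoffFilter a b c d δ with hl_def
    have hl : l ≤ atTop := inf_le_left
    have hI : ∀ i, SmoothCount.AvoidsIntegers l (L i) := by
      intro i
      refine SmoothCount.avoidsIntegers_cutoffFilter hδ ?_ (hpos i)
      fin_cases i <;> simp
    have hs : ∀ i, Tendsto (SmoothCount.sinSum (L i) (log x)) l (𝓝 (σ i)) := fun i =>
      SmoothCount.tendsto_sinSum_B1star hl (hpos i) (hI i) hy
    have pair : ∀ (u v : ℕ) (i j : Fin 4) (p : ℝ), log u = L i → log v = L j → i ≠ j →
        Tendsto (fun R => SmoothCount.cosCotSum (L i) (L j) (log x) R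
          + SmoothCount.cosCotSum (L j) (L i) (log x) R) l (𝓝 p) →
        Tendsto (SmoothCount.pairSum u v x) l (𝓝 (p + (σ i + σ j))) := by
      intro u v i j p hu hv hij h
      refine (h.add ((hs i).add (hs j))).congr fun R => ?_
      rw [SmoothCount.pairSum_eq, hu, hv]
      · rw [hu, hv]; exact hsin i j hij.symm
      · rw [hu, hv]; exact hsin j i hij
    have triple : ∀ (u v w : ℕ) (i j m : Fin 4) (t : ℝ), log u = L i → log v = L j →
        log w = L m → i ≠ j → i ≠ m → j ≠ m →
        Tendsto (fun R => SmoothCount.sinCotCotSum (L i) (L j) (L m) (log x) R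
          + SmoothCount.sinCotCotSum (L j) (L i) (L m) (log x) R
          + SmoothCount.sinCotCotSum (L m) (L i) (L j) (log x) R) l (𝓝 t) →
        Tendsto (SmoothCount.doubleSineTriple u v w x) l
          (𝓝 (2 * t + 2 * (σ i + σ j + σ m))) := by
      intro u v w i j m t hu hv hw hij him hjm h
      refine ((h.const_mul 2).add
        ((((hs i).add (hs j)).add (hs m)).const_mul 2)).congr fun R => ?_
      rw [SmoothCount.doubleSineTriple, SmoothCount.doubleSineSum_eq,
        SmoothCount.doubleSineSum_eq, SmoothCount.doubleSineSum_eq, hu, hv, hw]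
      · ring
      · rw [hu, hw]; exact hsin m i him
      · rw [hv, hw]; exact hsin m j hjm
      · rw [hv, hu]; exact hsin j i hij
      · rw [hv, hw]; exact hsin j m hjm.symm
      · rw [hu, hv]; exact hsin i j hij.symm
      · rw [hu, hw]; exact hsin i m him.symm
    refine ⟨pair a b 0 1 p01 L0.symm L1.symm (by decide) (h01 l hl hI),
      pair a c 0 2 p02 L0.symm L2.symm (by decide) (h02 l hl hI),
      pair a d 0 3 p03 L0.symm L3.symm (by decide) (h03 l hl hI),
      pair b c 1 2 p12 L1.symm L2.symm (by decide) (h12 l hl hI),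
      pair b d 1 3 p13 L1.symm L3.symm (by decide) (h13 l hl hI),
      pair c d 2 3 p23 L2.symm L3.symm (by decide) (h23 l hl hI),
      triple a b c 0 1 2 t012 L0.symm L1.symm L2.symm (by decide) (by decide) (by decide)
        (h012 l hl hI),
      triple a b d 0 1 3 t013 L0.symm L1.symm L3.symm (by decide) (by decide) (by decide)
        (h013 l hl hI),
      triple a c d 0 2 3 t023 L0.symm L2.symm L3.symm (by decide) (by decide) (by decide)
        (h023 l hl hI),
      triple b c d 1 2 3 t123 L1.symm L2.symm L3.symm (by decide) (by decide) (by decide)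
        (h123 l hl hI), ?_⟩
    have h4 := SmoothCount.tendsto_four hpos hinc hy hl hI
    rw [L0, L1, L2, L3, SmoothCount.latticeCount_eq_N_sub_chi ha hb hc hd hunique hx,
      SmoothCount.quarticCoeff_div_eq_mainPoly la.ne' lb.ne' lc.ne' ld.ne', Complex.ofReal_re,
      ← L0, ← L1, ← L2, ← L3] at h4
    have hsum := (((hs 0).add (hs 1)).add (hs 2)).add (hs 3)
    have htri := (((h012 l hl hI).add (h013 l hl hI)).add (h023 l hl hI)).add (h123 l hl hI)
    have hpair := (((((h01 l hl hI).add (h02 l hl hI)).add (h03 l hl hI)).add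
      (h12 l hl hI)).add (h13 l hl hI)).add (h23 l hl hI)
    -- Removing the sawtooth series, triples and pairs from the limit for four periods isolates the
    -- triple-cotangent series.
    refine ((((h4.const_mul (8 * π)).sub hsum).add htri).add hpair).congr fun R => ?_
    rw [SmoothCount.tripleCotQuadruple, SmoothCount.tripleCotSum_eq,
      SmoothCount.tripleCotSum_eq, SmoothCount.tripleCotSum_eq, SmoothCount.tripleCotSum_eq,
      ← L0, ← L1, ← L2, ← L3, ← mul_assoc, mul_one_div_cancel (by positivity), one_mul]
    ring
  -- Each base occurs once alone, in three pairs and in three triples, so its sawtooth value enters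
  -- `1 + 3 + 3 = 7` times with weight `1 / (8π)`.
  · simp only [hσ, L0, L1, L2, L3]
    have := pi_ne_zero
    field_simp
    ring
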